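/- Let $p\ge 3$ be a prime, let $K\subset\overline{\mathbf Q}_p$ be a finite extension of $\mathbf Q_p$ with uniformizer $\pi_K$ and residue field $k_K$, and let $\mathbf C_p^\flat$ be the tilt of $\mathbf C_p$, the fraction field of $\mathcal O_{\mathbf C_p}^\flat=\varprojlim_{x\mapsto x^p}\mathcal O_{\mathbf C_p}/p$, with its valuation $v^\flat$ given by $v^\flat(x)=v_p(x^\sharp)$, $v_p(p)=1$, and $v^\flat(0)=\infty$. Regard $k_K$ as a subfield of $\mathbf C_p^\flat$ through the Teichmüller embedding $x\mapsto([x],[x^{1/p}],[x^{1/p^2}],\dots)$. Fix a compatible system of $p$-power roots of $\pi_K$ and let $u_K=(\pi_K,\pi_K^{1/p},\pi_K^{1/p^2},\dots)\in\mathcal O_{\mathbf C_p}^\flat$. Let $K_{p^\infty}=K(\zeta_{p^\infty})$ and let $\mathbf E_K\subset\mathbf C_p^\flat$ be the image of the field of norms $X_K(K_{p^\infty})=\{0\}\cup\varprojlim_M M^\times$ ($M$ running through the finite extensions of $K$ in $K_{p^\infty}$, with the norms as transition maps) under the embedding $(\alpha_M)_M\mapsto(x_n)_{n\ge 0}$,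 $x_n=\lim_M\alpha_M^{[M:K_1]p^{-n}}$, where $K_1$ is the maximal tamely ramified extension of $K$ in $K_{p^\infty}$. Let $\eta_K$ be a uniformizer of $\mathbf E_K$ or, more generally, of $\varphi^s(\mathbf E_K)$ for some $s\in\mathbf Z$, where $\varphi$ is the Frobenius of $\mathbf C_p^\flat$. For $\alpha,\beta\in\mathcal O_{\mathbf C_p}^\flat$, $F=\sum_i F_iX^i\in k_K[[X]]$ and $f=\sum_{i,j}f_{ij}X^iY^j\in k_K[[X,Y]]$ write $F(\alpha)=\lim_{n\to\infty}\sum_{i\le n}F_i\alpha^i$ and $f(\alpha,\beta)=\lim_{n\to\infty}\sum_{i\le n}\sum_{j\le n}f_{ij}\alpha^i\beta^j$. Let $\theta\ge 1$ be an integer and let $0\ne F\in k_K[[X]]$ satisfy $v^\flat\left(\eta_K^\theta/F(u_K)\right)>0$. Then for every $f\in k_K[[X,Y]]$ the limit $\iota_{\theta,F}(f):=f\left(u_K,\eta_K^\theta/F(u_K)\right)$ exists and lies in $\mathcal O_{\mathbf C_p}^\flat$, and for every $n\in\mathbf N$ there exists $M(n)\in\mathbf Q_{>0}$ such that every $f=\sum_{i,j\ge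 0}f_{ij}X^iY^j\in k_K[[X,Y]]$ with $v^\flat(\iota_{\theta,F}(f))>M(n)$ satisfies $f_{ij}=0$ for all $0\le i,j\le n$. In particular, the map $\iota_{\theta,F}\colon k_K[[X,Y]]\to\mathcal O_{\mathbf C_p}^\flat$ is injective. As a special case ($\theta=1$, $F=1$), the map $f\mapsto f(u_K,\eta_K)$ is injective. -/

import Mathlib

open scoped NNReal Valued
open Filter Topology IsLocalRing

noncomputable section

namespace FalseTate

/-! ### The tilt of `ℂ_p` and its valuation -/

section Tilt

variable (p : ℕ) [Fact p.Prime]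

lemma valued_p_lt_one : Valued.v (p : ℂ_[p]) < 1 := by
  rw [PadicComplex.valuation_p]
  have h : (1 : ℝ≥0) < p := by exact_mod_cast (Fact.out : p.Prime).one_lt
  rw [one_div]
  exact inv_lt_one_of_one_lt₀ h

instance fact_not_isUnit_p : Fact (¬ IsUnit (p : 𝓞_ℂ_[p])) := ⟨fun h => by
  have h1 := (PadicComplexInt.integers p).one_of_isUnit h
  rw [map_natCast] at h1
  exact (valued_p_lt_one p).ne h1⟩

/-- The ring of integers `𝒪_{ℂ_p}^♭ = lim_{x ↦ x^p} 𝒪_{ℂ_p} / p` of the tilt of `ℂ_p`. -/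
abbrev OCpFlat : Type := PreTilt 𝓞_ℂ_[p] p

instance : IsDomain (OCpFlat p) :=
  PreTilt.isDomain ℂ_[p] (Valued.v : Valuation ℂ_[p] ℝ≥0) 𝓞_ℂ_[p] (PadicComplexInt.integers p) p

/-- The tilt `ℂ_p^♭`, as the fraction field of `𝒪_{ℂ_p}^♭`. -/
abbrev CpFlat : Type := FractionRing (OCpFlat p)

/-- The multiplicative absolute value `x ↦ |x^♯|` on `𝒪_{ℂ_p}^♭`, where `|p| = 1 / p`. -/
def tiltAbsInt : Valuation (OCpFlat p) ℝ≥0 :=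
  PreTilt.val ℂ_[p] (Valued.v : Valuation ℂ_[p] ℝ≥0) 𝓞_ℂ_[p] (PadicComplexInt.integers p) p

lemma nonZeroDivisors_le_primeCompl :
    nonZeroDivisors (OCpFlat p) ≤ (tiltAbsInt p).supp.primeCompl := by
  intro x hx hx0
  exact nonZeroDivisors.ne_zero hx
    ((PreTilt.map_eq_zero (PadicComplexInt.integers p)).1 ((Valuation.mem_supp_iff _ _).1 hx0))

/-- The multiplicative absolute value `x ↦ |x^♯|` on `ℂ_p^♭`. -/
def tiltAbs : Valuation (CpFlat p) ℝ≥0 :=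
  (tiltAbsInt p).extendToLocalization (nonZeroDivisors_le_primeCompl p) (CpFlat p)

variable {p}

open scoped Classical in
/-- The additive valuation `v^♭(x) = v_p(x^♯) = - log_p |x^♯|` on `ℂ_p^♭`, with `v^♭(0) = ∞`. -/
def vFlat (x : CpFlat p) : WithTop ℝ :=
  if x = 0 then ⊤ else ((-Real.logb p (tiltAbs p x) : ℝ) : WithTop ℝ)

/-- The inclusion `𝒪_{ℂ_p}^♭ ⊆ ℂ_p^♭`. -/
def ofInt (x : OCpFlat p) : CpFlat p := algebraMap (OCpFlat p) (CpFlat p) x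

/-- The element `(x_0, x_1, x_2, …)` of `𝒪_{ℂ_p}^♭` given by a sequence in `𝒪_{ℂ_p}` with
`x_{n+1}^p = x_n`. -/
def ofRoots (x : ℕ → 𝓞_ℂ_[p]) (hx : ∀ n, x (n + 1) ^ p = x n) : OCpFlat p :=
  ⟨fun n => Ideal.Quotient.mk _ (x n), fun n => by rw [← map_pow, hx n]⟩

/-- `s n → y` in `ℂ_p^♭` for the topology of `v^♭`. -/
def IsTiltLimit (s : ℕ → CpFlat p) (y : CpFlat p) : Prop :=
  ∀ C : ℝ, ∀ᶠ n in atTop, (C : WithTop ℝ) < vFlat (s n - y)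

open scoped Classical in
/-- The limit of a sequence in `ℂ_p^♭` (and `0` if there is none). -/
def tiltLim (s : ℕ → CpFlat p) : CpFlat p :=
  if h : ∃ y, IsTiltLimit s y then h.choose else 0

end Tilt

/-! ### Finite extensions `K` of `ℚ_p` inside the algebraic closure, and their residue fields -/

section LocalField

variable {p : ℕ} [Fact p.Prime] (K : IntermediateField ℚ_[p] (PadicAlgCl p))

/-- The ring of integers `𝒪_K = {x ∈ K : |x| ≤ 1}`. -/
abbrev intRing : Subring K := (NormedField.valuation (K := K)).integer

section
attribute [local instance] NormedField.toValued

instance : IsLocalRing (intRing K) := inferInstanceAs (IsLocalRing 𝒪[K])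

lemma intRing_dvr_finite [FiniteDimensional ℚ_[p] K] :
    IsDiscreteValuationRing (intRing K) ∧ Finite (ResidueField (intRing K)) := by
  have : ProperSpace K := FiniteDimensional.proper ℚ_[p] K
  have hc : CompactSpace 𝒪[K] := by
    rw [← isCompact_univ_iff, Subtype.isCompact_iff, Set.image_univ, Subtype.range_coe_subtype]
    have he : {x : K | x ∈ 𝒪[K]} = Metric.closedBall 0 1 := by
      ext x
      rw [mem_closedBall_zero_iff]
      exact Iff.rfl
    rw [he]
    exact isCompact_closedBall (0 : K) 1
  have hn : (Valued.v : Valuation K ℝ≥0).IsNontrivial := by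
    refine ⟨⟨algebraMap ℚ_[p] K p, ?_, ?_⟩⟩
    · simp [(Fact.out : p.Prime).ne_zero]
    · intro h
      have h1 : ‖algebraMap ℚ_[p] K p‖ = 1 := congrArg NNReal.toReal h
      rw [norm_algebraMap'] at h1
      exact Padic.norm_p_lt_one.ne h1
  have hd : IsDiscreteValuationRing 𝒪[K] :=
    Valued.integer.isDiscreteValuationRing_of_compactSpace (K := K)
  exact ⟨hd, inferInstanceAs (Finite (ResidueField 𝒪[K]))⟩
end

/-- The residue field `k_K`. -/
abbrev resField : Type := ResidueField (intRing K)

/-- The inclusion `𝒪_K → 𝒪_{ℂ_p}`. -/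
def intRingHom : intRing K →+* 𝓞_ℂ_[p] :=
  ((algebraMap K ℂ_[p]).comp (intRing K).subtype).codRestrict (PadicComplexInt p).toSubring
    (fun x => by
      change Valued.v (((x : K) : PadicAlgCl p) : ℂ_[p]) ≤ 1
      rw [PadicComplex.valuation_extends]
      exact x.2)

lemma natCast_p_mem : (p : intRing K) ∈ maximalIdeal (intRing K) := by
  rw [mem_maximalIdeal, mem_nonunits_iff]
  intro h
  have h1 := h.map (intRingHom K)
  rw [map_natCast] at h1
  exact (fact_not_isUnit_p p).out h1

instance : CharP (resField K) p := by
  refine (CharP.charP_iff_prime_eq_zero Fact.out).2 ?_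
  have h := (residue_eq_zero_iff (R := intRing K) _).2 (natCast_p_mem K)
  rwa [map_natCast] at h

variable [FiniteDimensional ℚ_[p] K]

instance : Finite (resField K) := (intRing_dvr_finite K).2

lemma exists_pow_mem : ∃ N : ℕ, ∀ x ∈ maximalIdeal (intRing K),
    intRingHom K x ^ p ^ N ∈ Ideal.span {(p : 𝓞_ℂ_[p])} := by
  have := (intRing_dvr_finite K).1
  have hp0 : (p : intRing K) ≠ 0 := by
    intro h
    have h1 := congrArg (fun x : intRing K => (x : K)) h
    simp only [Subring.coe_natCast, ZeroMemClass.coe_zero] at h1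
    have h2 : (algebraMap ℚ_[p] K) p = 0 := by rw [map_natCast]; exact h1
    simp [(Fact.out : p.Prime).ne_zero] at h2
  obtain ⟨π, hπ⟩ := IsDiscreteValuationRing.exists_irreducible (intRing K)
  obtain ⟨e, he⟩ := IsDiscreteValuationRing.associated_pow_irreducible hp0 hπ
  refine ⟨e, fun x hx => ?_⟩
  have hx1 : π ∣ x := by
    rw [hπ.maximalIdeal_eq] at hx
    exact Ideal.mem_span_singleton.1 hx
  have hx2 : (p : intRing K) ∣ x ^ p ^ e :=
    he.dvd.trans ((pow_dvd_pow_of_dvd hx1 e).trans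
      (pow_dvd_pow x (Nat.lt_pow_self (Fact.out : p.Prime).one_lt).le))
  rw [Ideal.mem_span_singleton, ← map_pow, ← map_natCast (intRingHom K)]
  exact map_dvd _ hx2

/-- An exponent `N` with `x^{p^N} ∈ p 𝒪_{ℂ_p}` for every `x` in the maximal ideal of `𝒪_K`. -/
def ramExp : ℕ := (exists_pow_mem K).choose

lemma ramExp_spec : ∀ x ∈ maximalIdeal (intRing K),
    intRingHom K x ^ p ^ ramExp K ∈ Ideal.span {(p : 𝓞_ℂ_[p])} :=
  (exists_pow_mem K).choose_spec

/-- The ring homomorphism `k_K → 𝒪_{ℂ_p} / p` sending the class of `a ∈ 𝒪_K` to the class of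
`a^{p^N}`. -/
def resPow : resField K →+* ModP 𝓞_ℂ_[p] p :=
  Ideal.Quotient.lift (maximalIdeal (intRing K))
    ((iterateFrobenius (ModP 𝓞_ℂ_[p] p) p (ramExp K)).comp
      ((Ideal.Quotient.mk (Ideal.span {(p : 𝓞_ℂ_[p])})).comp (intRingHom K)))
    (fun x hx => by
      rw [RingHom.comp_apply, RingHom.comp_apply, iterateFrobenius_def, ← map_pow]
      exact Ideal.Quotient.eq_zero_iff_mem.2 (ramExp_spec K x hx))

/-- The ring homomorphism `k_K → 𝒪_{ℂ_p} / p` lifting the inclusion of residue fields; it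
sends `x` to the class of `a^{p^N}` where `a ∈ 𝒪_K` is any lift of `x^{1/p^N}`. -/
def resModP : resField K →+* ModP 𝓞_ℂ_[p] p :=
  (resPow K).comp ((iterateFrobeniusEquiv (resField K) p (ramExp K)).symm : _ →+* _)

/-- The canonical embedding `k_K → 𝒪_{ℂ_p}^♭`, `x ↦ ([x], [x^{1/p}], [x^{1/p^2}], …) mod p`. -/
def resFlat : resField K →+* OCpFlat p :=
  Perfection.lift p (resField K) (ModP 𝓞_ℂ_[p] p) (resModP K)

/-- The canonical embedding lifts the inclusion of `k_K` into the residue field of `ℂ_p`. -/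
lemma resFlat_residue (a : intRing K) : ∃ z : 𝓞_ℂ_[p],
    PreTilt.coeff 0 (resFlat K (residue (intRing K) a)) = Ideal.Quotient.mk _ z ∧
      z - intRingHom K a ∈ maximalIdeal 𝓞_ℂ_[p] := by
  obtain ⟨b, hb⟩ := residue_surjective (R := intRing K)
    ((iterateFrobeniusEquiv (resField K) p (ramExp K)).symm (residue (intRing K) a))
  refine ⟨intRingHom K (b ^ p ^ ramExp K), ?_, ?_⟩
  · have h1 : PreTilt.coeff 0 (resFlat K (residue (intRing K) a)) =
        resModP K (residue (intRing K) a) := rfl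
    rw [h1, resModP, RingHom.comp_apply]
    have h2 : ((iterateFrobeniusEquiv (resField K) p (ramExp K)).symm :
        resField K →+* resField K) (residue (intRing K) a) = residue (intRing K) b := hb.symm
    rw [h2, map_pow, map_pow]
    rfl
  · have h3 : residue (intRing K) (b ^ p ^ ramExp K) = residue (intRing K) a := by
      rw [map_pow, hb, ← iterateFrobeniusEquiv_def, RingEquiv.apply_symm_apply]
    have h4 : b ^ p ^ ramExp K - a ∈ maximalIdeal (intRing K) := by
      rw [← residue_eq_zero_iff, map_sub, h3, sub_self]
    rw [← map_sub, mem_maximalIdeal, mem_nonunits_iff]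
    intro hu
    refine h4 ?_
    have h5 := (PadicComplexInt.integers p).isUnit_iff_valuation_eq_one.1 hu
    refine (Valuation.integer.integers
      (NormedField.valuation (K := K))).isUnit_iff_valuation_eq_one.2 ?_
    rw [← h5]
    exact (PadicComplex.valuation_extends p
      (((b ^ p ^ ramExp K - a : intRing K) : K) : PadicAlgCl p)).symm

end LocalField

/-! ### The field of norms of an extension `L / K` and its image in `ℂ_p^♭` -/

section FieldOfNorms

variable {p : ℕ} [Fact p.Prime]

/-- The set `ℰ(L/K)` of finite extensions of `K` contained in `L`, ordered by inclusion. -/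
abbrev FinSubext (K L : IntermediateField ℚ_[p] (PadicAlgCl p)) : Type :=
  {M : IntermediateField ℚ_[p] (PadicAlgCl p) // K ≤ M ∧ M ≤ L ∧ FiniteDimensional ℚ_[p] M}

/-- The norm map `N_{N/M} : N → M` for `M ⊆ N`. -/
def relNorm {M N : IntermediateField ℚ_[p] (PadicAlgCl p)} (h : M ≤ N) (x : N) : M :=
  Algebra.norm M (⟨x.1, x.2⟩ : IntermediateField.extendScalars h)

/-- The elements of `X_K(L) = {0} ∪ lim M^×`: the norm compatible families `(α_M)`.
(If one component of such a family vanishes, then all of them do.) -/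
structure NormSystem (K L : IntermediateField ℚ_[p] (PadicAlgCl p)) where
  /-- the component `α_M` -/
  comp : ∀ M : FinSubext K L, M.1
  norm_comp : ∀ (M N : FinSubext K L) (h : M.1 ≤ N.1), relNorm h (comp N) = comp M

/-- The value group `|M^×|`. -/
def valueGroup (M : IntermediateField ℚ_[p] (PadicAlgCl p)) : Subgroup ℝˣ :=
  (Units.map (normHom (α := M) : M →* ℝ)).range

/-- The ramification index `e(M/K) = [|M^×| : |K^×|]`. -/
def ramIdx (K M : IntermediateField ℚ_[p] (PadicAlgCl p)) : ℕ :=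
  (valueGroup K).relIndex (valueGroup M)

/-- The maximal tamely ramified extension of `K` in `L`: the compositum of all finite
subextensions whose ramification index is prime to `p`. -/
def maxTame (K L : IntermediateField ℚ_[p] (PadicAlgCl p)) :
    IntermediateField ℚ_[p] (PadicAlgCl p) :=
  sSup {M | K ≤ M ∧ M ≤ L ∧ FiniteDimensional ℚ_[p] M ∧ ¬ p ∣ ramIdx K M}

/-- `x = (x_n mod p)_n ∈ 𝒪_{ℂ_p}^♭` is the image of `α ∈ X_K(L)`: with `K_1` the maximal tamely
ramified extension of `K` in `L`, `x_n` is the limit of `α_M ^ ([M : K_1] / p^n)` over the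
directed set of finite subextensions `M` (for which `p^n` eventually divides `[M : K_1]`). -/
def IsNormImage {K L : IntermediateField ℚ_[p] (PadicAlgCl p)} (α : NormSystem K L)
    (x : OCpFlat p) : Prop :=
  ∀ n : ℕ, ∃ y : 𝓞_ℂ_[p], PreTilt.coeff n x = Ideal.Quotient.mk _ y ∧
    Tendsto (fun M : FinSubext K L => (((α.comp M : M.1) : PadicAlgCl p) : ℂ_[p]) ^
      ((maxTame K L).relfinrank M.1 / p ^ n)) atTop (𝓝 (y : ℂ_[p]))

/-- The ring of integers of the image of `X_K(L)` in `ℂ_p^♭`. -/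
def normFieldInt (K L : IntermediateField ℚ_[p] (PadicAlgCl p)) : Set (OCpFlat p) :=
  {x | ∃ α : NormSystem K L, IsNormImage α x}

/-- The cyclotomic extension `K_{p^∞} = K(ζ_{p^∞})`. -/
def cyclotomic (K : IntermediateField ℚ_[p] (PadicAlgCl p)) :
    IntermediateField ℚ_[p] (PadicAlgCl p) :=
  K ⊔ IntermediateField.adjoin ℚ_[p] {ζ | ∃ n : ℕ, ζ ^ p ^ n = 1}

/-- `π` is a uniformizer of `K`: a nonzero element of largest absolute value `< 1`. -/
def IsUniformizer (K : IntermediateField ℚ_[p] (PadicAlgCl p)) (π : K) : Prop :=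
  π ≠ 0 ∧ ‖π‖ < 1 ∧ ∀ x : K, ‖x‖ < 1 → ‖x‖ ≤ ‖π‖

/-- `ω` is a uniformizer of `𝐄_K`, the image in `ℂ_p^♭` of the field of norms `X_K(K_{p^∞})`:
a nonzero element of smallest positive valuation. -/
def IsEUniformizer (K : IntermediateField ℚ_[p] (PadicAlgCl p)) (ω : OCpFlat p) : Prop :=
  ω ∈ normFieldInt K (cyclotomic K) ∧ ω ≠ 0 ∧ 0 < vFlat (ofInt ω) ∧
    ∀ x ∈ normFieldInt K (cyclotomic K), 0 < vFlat (ofInt x) → vFlat (ofInt ω) ≤ vFlat (ofInt x)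

/-- `η` is a uniformizer of `φ^s(𝐄_K)` for some `s ∈ ℤ`, where `φ` is the Frobenius of `ℂ_p^♭`;
for `a = b = 0` it is a uniformizer of `𝐄_K` itself. Allowing `s` makes the notion independent of
the normalization of the embedding `X_K(K_{p^∞}) → ℂ_p^♭`: for `K = ℚ_p` the field of norms of the
cyclotomic tower has image `𝔽_p((ε^{1/p} - 1))` under the embedding above, and `ε - 1` is a
uniformizer of its image under `φ`. -/
def IsEta (K : IntermediateField ℚ_[p] (PadicAlgCl p)) (η : OCpFlat p) : Prop :=
  ∃ ω : OCpFlat p, IsEUniformizer K ω ∧ ∃ a b : ℕ, η ^ p ^ a = ω ^ p ^ b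

end FieldOfNorms

/-! ### Values of power series over `k_K` at points of `ℂ_p^♭` -/

section Evaluation

variable {p : ℕ} [Fact p.Prime] {K : IntermediateField ℚ_[p] (PadicAlgCl p)}

/-- The coefficient `f_{ij}` of `X^i Y^j` in `f ∈ k⟦X, Y⟧`. -/
def coeff₂ {k : Type*} [CommRing k] (f : MvPowerSeries (Fin 2) k) (i j : ℕ) : k :=
  MvPowerSeries.coeff (Finsupp.single 0 i + Finsupp.single 1 j) f

variable [FiniteDimensional ℚ_[p] K]

/-- `F(α) = lim_n ∑_{i ≤ n} F_i α^i`. -/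
def eval₁ (F : PowerSeries (resField K)) (α : CpFlat p) : CpFlat p :=
  tiltLim fun n => ∑ i ∈ Finset.range (n + 1), ofInt (resFlat K (PowerSeries.coeff i F)) * α ^ i

/-- The partial sums `∑_{i ≤ n} ∑_{j ≤ n} f_{ij} α^i β^j`. -/
def partialSum₂ (f : MvPowerSeries (Fin 2) (resField K)) (α β : CpFlat p) (n : ℕ) : CpFlat p :=
  ∑ i ∈ Finset.range (n + 1), ∑ j ∈ Finset.range (n + 1),
    ofInt (resFlat K (coeff₂ f i j)) * α ^ i * β ^ j

/-- `f(α, β) = lim_n ∑_{i ≤ n} ∑_{j ≤ n} f_{ij} α^i β^j`. -/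
def eval₂ (f : MvPowerSeries (Fin 2) (resField K)) (α β : CpFlat p) : CpFlat p :=
  tiltLim (partialSum₂ f α β)

end Evaluation

end FalseTate

end

/-!
# Analytic independence of `u_K` and `η_K ^ θ / F(u_K)`

Put `u = u_K`, `e = η_K ^ θ` and `b = e / F(u)`. The proof compares `u` with its Galois conjugates
over the cyclotomic tower.

* *Galois theory.* Not all `p`-power roots `ϖ_n` of the uniformizer lie in `K(ζ_{p^∞})`
  (`IsUniformizer.exists_notMem_cyclotomic`): as that extension is abelian, for each `τ` fixing `K`
  and acting on the `p^n`-th roots of unity by `ζ ↦ ζ^m`, the element `ϖ_n^m / τ(ϖ_n)` would be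
  invariant under all conjugations, hence in `K`; comparing absolute values gives `p^n ∣ m - 1`, so
  that `K` would contain all roots of unity of `p`-power order. Hence some automorphism `σ` over
  `K(ζ_{p^∞})` multiplies `u` by a nontrivial compatible system `q` of `p`-power roots of unity
  (`IsUniformizer.exists_conjFlat_ofRoots_eq`). It fixes `q`, the constants `k_K`, and, by
  continuity, every element of the image of the field of norms. So it fixes `η_K`; nothing else
  about the field of norms is needed.

* *Eigenvectors.* Writing `F = X^d U` with a unit `U` and replacing `b` by `b U(u)`, one may assume
  `u^d b = e`. Then `u^i b^j` is an eigenvector of `σ` with eigenvalue `q^(i - dj)`. If a convergent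
  sum of eigenvectors `a_α` with eigenvalues `q^(w α)` vanishes, so does the sum of those with a
  given eigenvalue (`tsum_eigenspace_eq_zero`): applying powers of `σ` gives `∑ a_α Q^(w α) = 0` for
  `Q = q^(p^k)`; since `Q^N = 1 + (Q - 1)^N` for `N = p^s`, this sum is, modulo `(Q - 1)^N`,
  the value at `Q` of a polynomial of degree `< N` whose coefficients are the sums of the `a_α` over
  the residue classes of `w` modulo `N`. Expanded in powers of `Q - 1`, this polynomial has to vanish
  because `Q - 1` takes arbitrarily small nonzero values. Letting `s` tend to infinity isolates a
  single eigenvalue.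

* *Conclusion.* If `f(u, b) = 0`, then the monomials with fixed `i - dj` sum to zero. Up to a power
  of `u` they are powers of `e`, which is analytically transcendental over `k_K`, so `f = 0`
  (`eq_zero_of_evalAt₂_eq_zero`). As `k_K` is finite, the space of power series is compact, and the
  bounds `M(n)` follow from injectivity (`exists_pos_forall_norm_evalAt₂_lt`).

The convergence statements use that `𝒪_{ℂ_p}^♭` is complete for `|x^♯|` and a valuation ring
(`dvd_of_tiltAbsInt_le`).
-/

noncomputable section

namespace FalseTate

/-! ### Eigenvector decompositions in complete ultrametric rings of characteristic `p` -/

section Eigen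

open Polynomial

variable {R : Type*} [NormedCommRing R]

lemma norm_le_of_dvd [NormMulClass R] (hle : ∀ x : R, ‖x‖ ≤ 1) {x y : R} (h : x ∣ y) :
    ‖y‖ ≤ ‖x‖ := by
  obtain ⟨z, rfl⟩ := h
  rw [norm_mul]
  exact mul_le_of_le_one_right (norm_nonneg _) (hle z)

/-- A polynomial of degree `< N` vanishes as soon as its values at a sequence of nonzero points
`T k → 0` are divisible by `T k ^ N`. -/
lemma polynomial_eq_zero_of_pow_dvd_eval [NormMulClass R] [IsDomain R]
    (hle : ∀ x : R, ‖x‖ ≤ 1) {P : R[X]} {N : ℕ} (hP : P.natDegree < N) {T : ℕ → R}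
    (hT0 : ∀ k, T k ≠ 0) (hT : Tendsto T atTop (𝓝 0)) (h : ∀ k, T k ^ N ∣ P.eval (T k)) :
    P = 0 := by
  have key : ∀ l, P.coeff l = 0 := by
    intro l
    induction l using Nat.strong_induction_on with
    | _ l ih =>
    by_cases hl : N ≤ l
    · exact coeff_eq_zero_of_natDegree_lt (hP.trans_le hl)
    push Not at hl
    have hdvd : ∀ k, T k ∣ P.coeff l := by
      intro k
      have h1 := h k
      rw [eval_eq_sum_range' hP, ← Finset.add_sum_erase _ _ (Finset.mem_range.2 hl)] at h1
      have h2 : T k ^ (l + 1) ∣ ∑ i ∈ (Finset.range N).erase l, P.coeff i * T k ^ i := by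
        refine Finset.dvd_sum fun i hi => ?_
        rcases lt_trichotomy i l with hil | hil | hil
        · rw [ih i hil, zero_mul]; exact dvd_zero _
        · exact absurd hil (Finset.ne_of_mem_erase hi)
        · exact (pow_dvd_pow _ hil).mul_left _
      have h3 := (dvd_add_left h2).1 ((pow_dvd_pow (T k) hl).trans h1)
      rw [pow_succ', mul_dvd_mul_iff_right (pow_ne_zero _ (hT0 k))] at h3
      exact h3
    rw [← norm_le_zero_iff]
    have hT' : Tendsto (fun k => ‖T k‖) atTop (𝓝 0) := by simpa using hT.norm
    exact ge_of_tendsto' hT' fun k => norm_le_of_dvd hle (hdvd k)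
  ext l
  simp [key l]

lemma sub_one_dvd_units_zpow_sub_one {A : Type*} [CommRing A] (x : Aˣ) (z : ℤ) :
    (x : A) - 1 ∣ ((x ^ z : Aˣ) : A) - 1 := by
  obtain ⟨n, rfl | rfl⟩ := z.eq_nat_or_neg
  · simpa using sub_one_dvd_pow_sub_one (x : A) n
  · have h : ((x ^ (-(n : ℤ)) : Aˣ) : A) - 1 = -((x ^ (-(n : ℤ)) : Aˣ) : A) * ((x : A) ^ n - 1) := by
      have h1 : ((x ^ (-(n : ℤ)) : Aˣ) : A) * (x : A) ^ n = 1 := by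
        rw [← Units.val_pow_eq_pow_val, ← Units.val_mul]
        simp
      rw [mul_sub, neg_mul, h1]
      ring
    rw [h]
    exact (sub_one_dvd_pow_sub_one (x : A) n).mul_left _

lemma summable_norm_ite {ι : Type*} {a : ι → R} (ha : Summable fun α => ‖a α‖)
    (P : ι → Prop) [DecidablePred P] : Summable fun α => ‖if P α then a α else 0‖ :=
  ha.of_nonneg_of_le (fun _ => norm_nonneg _) fun α => by
    split_ifs
    · exact le_rfl
    · simp

variable {p : ℕ} [Fact p.Prime] [CharP R p]

/-- In characteristic `p`, the power `Q ^ w` only depends on `w` modulo `p ^ s`, up to a multiple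
of `(Q - 1) ^ p ^ s`. -/
lemma sub_one_pow_dvd_zpow_sub_pow (Q : Rˣ) (w : ℤ) (s : ℕ) :
    ((Q : R) - 1) ^ p ^ s ∣ ((Q ^ w : Rˣ) : R) - (Q : R) ^ (w % (p ^ s : ℕ)).toNat := by
  have hN : 0 < p ^ s := pow_pos (Fact.out : p.Prime).pos s
  set r : ℕ := (w % (p ^ s : ℕ)).toNat with hr
  have hr' : (r : ℤ) = w % (p ^ s : ℕ) :=
    Int.toNat_of_nonneg (Int.emod_nonneg _ (by exact_mod_cast hN.ne'))
  have hw : w = (p ^ s : ℕ) * (w / (p ^ s : ℕ)) + r := by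
    rw [hr']; exact (Int.mul_ediv_add_emod _ _).symm
  have h1 : ((Q ^ w : Rˣ) : R) - (Q : R) ^ r =
      ((((Q ^ p ^ s) ^ (w / (p ^ s : ℕ)) : Rˣ) : R) - 1) * (Q : R) ^ r := by
    conv_lhs => rw [hw, zpow_add, zpow_mul, zpow_natCast, zpow_natCast]
    push_cast
    ring
  rw [h1, sub_pow_char_pow, one_pow, ← Units.val_pow_eq_pow_val]
  exact (sub_one_dvd_units_zpow_sub_one _ _).mul_right _

variable [NormMulClass R] [IsDomain R] [IsUltrametricDist R] [CompleteSpace R]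

/-- If `∑ a_α Q ^ w α = 0` for all `Q = q ^ p ^ k`, then the sum of the `a_α` over any residue
class of `w` modulo `p ^ s` vanishes. -/
lemma tsum_residue_class_eq_zero (hle : ∀ x : R, ‖x‖ ≤ 1) {q : Rˣ} (hq1 : q ≠ 1)
    (hq : ‖(q : R) - 1‖ < 1) {ι : Type*} {a : ι → R} (ha : Summable fun α => ‖a α‖) (w : ι → ℤ)
    (h0 : ∀ k : ℕ, ∑' α, a α * (((q ^ p ^ k) ^ w α : Rˣ) : R) = 0) (s : ℕ) (m : ℤ) :
    ∑' α, (if w α % (p ^ s : ℕ) = m % (p ^ s : ℕ) then a α else 0) = 0 := by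
  have hN : 0 < p ^ s := pow_pos (Fact.out : p.Prime).pos s
  have hN' : ((p ^ s : ℕ) : ℤ) ≠ 0 := by exact_mod_cast hN.ne'
  set N := p ^ s with hNdef
  let r : ι → ℕ := fun α => (w α % (N : ℤ)).toNat
  have hrN : ∀ α, r α < N := fun α => by
    have h1 := Int.emod_lt_of_pos (w α) (b := (N : ℤ)) (by exact_mod_cast hN)
    have h2 := Int.emod_nonneg (w α) hN'
    simp only [r]
    omega
  let S : ℕ → R := fun i => ∑' α, if r α = i then a α else 0
  let P : R[X] := ∑ i ∈ Finset.range N, monomial i (S i)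
  have hcoeff : ∀ i < N, P.coeff i = S i := by
    intro i hi
    simp only [P, finsetSum_coeff, coeff_monomial]
    rw [Finset.sum_ite_eq', if_pos (Finset.mem_range.2 hi)]
  have hdeg : P.natDegree < N := by
    rw [Nat.lt_iff_le_pred hN]
    refine natDegree_sum_le_of_forall_le _ _ fun i hi => (natDegree_monomial_le _).trans ?_
    have := Finset.mem_range.1 hi
    omega
  have hq0 : (q : R) - 1 ≠ 0 := by
    rw [sub_ne_zero]
    exact fun h => hq1 (Units.ext h)
  have hT : ∀ k, (((q ^ p ^ k : Rˣ) : R)) - 1 = ((q : R) - 1) ^ p ^ k := fun k => by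
    rw [sub_pow_char_pow, one_pow, Units.val_pow_eq_pow_val]
  have hP : taylor 1 P = 0 := by
    refine polynomial_eq_zero_of_pow_dvd_eval hle (N := N) (by rwa [natDegree_taylor])
      (T := fun k => ((q ^ p ^ k : Rˣ) : R) - 1) (fun k => ?_) ?_ fun k => ?_
    · rw [hT]; exact pow_ne_zero _ hq0
    · simp_rw [hT]
      exact (tendsto_pow_atTop_nhds_zero_of_norm_lt_one hq).comp
        (tendsto_pow_atTop_atTop_of_one_lt (Fact.out : p.Prime).one_lt)
    · set Q : Rˣ := q ^ p ^ k
      rw [taylor_eval, sub_add_cancel]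
      choose b hb using fun α => sub_one_pow_dvd_zpow_sub_pow (p := p) Q (w α) s
      have hs1 : Summable fun α => a α * (Q : R) ^ r α :=
        Summable.of_norm_bounded ha fun α => by
          rw [norm_mul]; exact mul_le_of_le_one_right (norm_nonneg _) (hle _)
      have hs2 : Summable fun α => a α * b α :=
        Summable.of_norm_bounded ha fun α => by
          rw [norm_mul]; exact mul_le_of_le_one_right (norm_nonneg _) (hle _)
      have h1 : P.eval (Q : R) = ∑' α, a α * (Q : R) ^ r α := by
        have h2 : ∀ α, a α * (Q : R) ^ r α =
            ∑ i ∈ Finset.range N, (if r α = i then a α else 0) * (Q : R) ^ i := fun α => by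
          rw [Finset.sum_eq_single_of_mem (r α) (Finset.mem_range.2 (hrN α)), if_pos rfl]
          intro i _ hi
          rw [if_neg hi.symm, zero_mul]
        have h3 : ∀ i, Summable fun α => if r α = i then a α else 0 := fun i =>
          (summable_norm_ite ha _).of_norm
        simp_rw [h2]
        rw [Summable.tsum_finsetSum fun i _ => (h3 i).mul_right _]
        simp only [P, eval_finsetSum, eval_monomial]
        exact Finset.sum_congr rfl fun i _ => ((h3 i).tsum_mul_right _).symm
      have h4 : ∑' α, a α * (Q : R) ^ r α = -(((Q : R) - 1) ^ N * ∑' α, a α * b α) := by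
        rw [eq_neg_iff_add_eq_zero, ← hs2.tsum_mul_left, ← hs1.tsum_add (hs2.mul_left _), ← h0 k]
        refine tsum_congr fun α => ?_
        linear_combination (-a α) * hb α
      rw [h1, h4]
      exact (Dvd.intro _ rfl).neg_right
  have hP0 : P = 0 := taylor_injective 1 (by rw [hP, map_zero])
  have hm := Int.emod_nonneg m hN'
  have hm' := Int.emod_lt_of_pos m (b := (N : ℤ)) (by exact_mod_cast hN)
  have h5 := hcoeff (m % (N : ℤ)).toNat (by omega)
  rw [hP0, coeff_zero] at h5
  refine Eq.trans ?_ h5.symm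
  refine tsum_congr fun α => ?_
  have h6 := Int.emod_nonneg (w α) hN'
  refine if_congr ?_ rfl rfl
  simp only [r]
  omega

/-- A summable family of eigenvectors of a continuous ring endomorphism `σ`, with eigenvalues
powers `q ^ w α` of a `σ`-invariant unit `q ≠ 1` close to `1`: if the sum of the family vanishes,
then so does the sum of its members with a given eigenvalue. -/
lemma tsum_eigenspace_eq_zero (p : ℕ) [Fact p.Prime] [CharP R p] (hle : ∀ x : R, ‖x‖ ≤ 1) {q : Rˣ} (hq1 : q ≠ 1)
    (hq : ‖(q : R) - 1‖ < 1) {σ : R →+* R} (hσ : Continuous σ) (hσq : Units.map (σ : R →* R) q = q)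
    {ι : Type*} {a : ι → R} (ha : Summable fun α => ‖a α‖) (w : ι → ℤ)
    (hσa : ∀ α, σ (a α) = ((q ^ w α : Rˣ) : R) * a α) (h0 : ∑' α, a α = 0) (m : ℤ) :
    ∑' α, (if w α = m then a α else 0) = 0 := by
  have hσw : ∀ z : ℤ, σ ((q ^ z : Rˣ) : R) = ((q ^ z : Rˣ) : R) := fun z => by
    have h : Units.map (σ : R →* R) (q ^ z) = q ^ z := by rw [map_zpow, hσq]
    exact congrArg Units.val h
  have hiter : ∀ n : ℕ, ∀ α, σ^[n] (a α) = a α * (((q ^ n) ^ w α : Rˣ) : R) := by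
    intro n α
    induction n with
    | zero => simp
    | succ n ih =>
      rw [Function.iterate_succ_apply', ih, map_mul, hσa, ← zpow_natCast, ← zpow_mul, hσw,
        mul_comm _ (a α), mul_assoc, ← Units.val_mul, ← zpow_add, ← zpow_natCast q (n + 1),
        ← zpow_mul]
      congr 3
      push_cast
      ring
  have hsum : ∀ n : ℕ, ∑' α, a α * (((q ^ n) ^ w α : Rˣ) : R) = 0 := by
    intro n
    simp_rw [← hiter]
    have h1 : HasSum (fun α => σ^[n] (a α)) (σ^[n] 0) := by
      have h2 : HasSum a 0 := h0 ▸ ha.of_norm.hasSum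
      have h3 := h2.map (σ ^ n) (by rw [RingHom.coe_pow]; exact hσ.iterate n)
      simpa only [Function.comp_def, RingHom.coe_pow] using h3
    rw [h1.tsum_eq, ← RingHom.coe_pow, map_zero]
  rw [← norm_le_zero_iff]
  refine le_of_forall_pos_le_add fun ε hε => ?_
  rw [zero_add]
  -- Only finitely many terms are larger than `ε`; modulo a large power of `p`, the weights of
  -- those are congruent to `m` only if they are equal to `m`.
  have hfin : {α | ε < ‖a α‖}.Finite := by
    have h1 := ha.tendsto_cofinite_zero.eventually (gt_mem_nhds hε)
    refine Set.Finite.subset h1 fun α hα => ?_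
    simp only [Set.mem_compl_iff, Set.mem_ofPred_eq, not_lt] at hα ⊢
    exact hα.le
  obtain ⟨B, hB⟩ := (hfin.image fun α => (w α - m).natAbs).bddAbove
  have hBs : B < p ^ B := Nat.lt_pow_self (Fact.out : p.Prime).one_lt
  have h2 := tsum_residue_class_eq_zero hle hq1 hq ha w (fun k => hsum (p ^ k)) B m
  rcases isEmpty_or_nonempty ι with hι | hι
  · simp [hε.le]
  have h3 : ∑' α, (if w α = m then a α else 0) = -∑' α, ((if w α % (p ^ B : ℕ) = m % (p ^ B : ℕ)
      then a α else 0) - if w α = m then a α else 0) := by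
    rw [Summable.tsum_sub (summable_norm_ite ha _).of_norm (summable_norm_ite ha _).of_norm, h2,
      zero_sub, neg_neg]
  rw [h3, norm_neg]
  refine IsUltrametricDist.norm_tsum_le_of_forall_le fun α => ?_
  by_cases h4 : w α = m
  · simp [h4, hε.le]
  rw [if_neg h4, sub_zero]
  split_ifs with h5
  · by_contra! h6
    have h7 : (w α - m).natAbs ≤ B := hB ⟨α, h6, rfl⟩
    have h8 : ((p ^ B : ℕ) : ℤ) ∣ w α - m := Int.ModEq.dvd (Int.ModEq.symm h5)
    have h9 := Nat.le_of_dvd (by omega) (Int.natCast_dvd.1 h8)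
    omega
  · simp [hε.le]

end Eigen

/-! ### Convergent power series in one and two variables -/

section PowerSeriesEval

variable {R : Type*} [NormedCommRing R] {k : Type*} [Field k] (c : k →+* R)

/-- The value `∑ F_i u^i` of a power series over `k` at a point `u` of a normed ring receiving a map `c`
from `k` (with the value `0` where the sum diverges). -/
def evalAt (u : R) (F : PowerSeries k) : R := ∑' i, c (PowerSeries.coeff i F) * u ^ i

/-- The value `∑ f_{ij} u^i b^j`, where the power series `f j` is the coefficient of `b^j`
(with the value `0` where the double sum diverges). -/
def evalAt₂ (u b : R) (f : ℕ → PowerSeries k) : R :=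
  ∑' α : ℕ × ℕ, c (PowerSeries.coeff α.1 (f α.2)) * u ^ α.1 * b ^ α.2

variable {c}

lemma evalAt_one (u : R) : evalAt c u 1 = 1 := by
  rw [evalAt, tsum_eq_single 0]
  · simp
  · intro i hi
    simp [PowerSeries.coeff_one, hi]

lemma evalAt_X_pow (u : R) (n : ℕ) : evalAt c u (PowerSeries.X ^ n) = u ^ n := by
  rw [evalAt, tsum_eq_single n]
  · simp
  · intro i hi
    simp [PowerSeries.coeff_X_pow, hi]

variable [NormMulClass R]

lemma norm_mul_le_right_of_forall_le_one (hle : ∀ x : R, ‖x‖ ≤ 1) (x y : R) : ‖x * y‖ ≤ ‖y‖ := by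
  rw [norm_mul]; exact mul_le_of_le_one_left (norm_nonneg _) (hle x)

variable [IsDomain R]

lemma norm_eq_one_of_isUnit (hle : ∀ x : R, ‖x‖ ≤ 1) {x : R} (hx : IsUnit x) : ‖x‖ = 1 := by
  obtain ⟨y, hy⟩ := hx.exists_right_inv
  have : NormOneClass R := NormMulClass.toNormOneClass
  have h := congrArg norm hy
  rw [norm_mul, norm_one] at h
  have h1 := mul_le_of_le_one_right (norm_nonneg x) (hle y)
  exact le_antisymm (hle x) (h ▸ h1)

lemma norm_coeff_eq_one (hle : ∀ x : R, ‖x‖ ≤ 1) {x : k} (hx : x ≠ 0) : ‖c x‖ = 1 :=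
  norm_eq_one_of_isUnit hle ((Ne.isUnit hx).map c)

lemma summable_norm_mul_pow (hle : ∀ x : R, ‖x‖ ≤ 1) {u : R} (hu : ‖u‖ < 1) (x : ℕ → R) :
    Summable fun i => ‖x i * u ^ i‖ := by
  have : NormOneClass R := NormMulClass.toNormOneClass
  refine (summable_geometric_of_lt_one (norm_nonneg u) hu).of_nonneg_of_le
    (fun _ => norm_nonneg _) fun i => ?_
  rw [← norm_pow]
  exact norm_mul_le_right_of_forall_le_one hle _ _

lemma summable_norm_mul_pow₂ (hle : ∀ x : R, ‖x‖ ≤ 1) {u b : R} (hu : ‖u‖ < 1) (hb : ‖b‖ < 1)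
    (x : ℕ × ℕ → R) : Summable fun α : ℕ × ℕ => ‖x α * u ^ α.1 * b ^ α.2‖ := by
  have : NormOneClass R := NormMulClass.toNormOneClass
  refine ((summable_geometric_of_lt_one (norm_nonneg u) hu).mul_of_nonneg
    (summable_geometric_of_lt_one (norm_nonneg b) hb) (fun _ => by positivity)
    fun _ => by positivity).of_nonneg_of_le (fun _ => norm_nonneg _) fun α => ?_
  rw [← norm_pow, ← norm_pow, ← norm_mul, mul_assoc]
  exact norm_mul_le_right_of_forall_le_one hle _ _

/-- A multiple `∑ a x_α e ^ J α` of a sum with coefficients in `k` and pairwise distinct exponents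
vanishes only if all coefficients do: the term with the smallest exponent dominates the others. -/
lemma coeff_eq_zero_of_tsum_mul_pow_eq_zero [IsUltrametricDist R]
    (hle : ∀ x : R, ‖x‖ ≤ 1) {a e : R} (ha : a ≠ 0)
    (he0 : e ≠ 0) (he : ‖e‖ < 1) {ι : Type*} {x : ι → k} {J : ι → ℕ}
    (hJ : ∀ α β, x α ≠ 0 → x β ≠ 0 → J α = J β → α = β)
    (hs : Summable fun α => a * (c (x α) * e ^ J α))
    (h0 : ∑' α, a * (c (x α) * e ^ J α) = 0) : x = 0 := by
  classical
  have : NormOneClass R := NormMulClass.toNormOneClass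
  by_contra hx
  obtain ⟨α₀, hα₀⟩ := Function.ne_iff.1 hx
  obtain ⟨α, hα, hmin⟩ := exists_minimalFor_of_wellFoundedLT (fun α => x α ≠ 0) J ⟨α₀, hα₀⟩
  rw [hs.tsum_eq_add_tsum_ite α] at h0
  have : Nonempty ι := ⟨α⟩
  have h1 : ‖∑' β, if β = α then 0 else a * (c (x β) * e ^ J β)‖ ≤ ‖a‖ * ‖e‖ ^ (J α + 1) := by
    refine IsUltrametricDist.norm_tsum_le_of_forall_le fun β => ?_
    split_ifs with hβ
    · rw [norm_zero]; positivity
    by_cases hxβ : x β = 0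
    · rw [hxβ, map_zero, zero_mul, mul_zero, norm_zero]; positivity
    have hlt : J α + 1 ≤ J β := by
      rcases le_total (J β) (J α) with h | h
      · exact absurd (hJ _ _ hxβ hα (le_antisymm h (hmin hxβ h))) hβ
      · exact lt_of_le_of_ne h fun h' => hβ (hJ _ _ hxβ hα h'.symm)
    rw [norm_mul]
    refine mul_le_mul_of_nonneg_left ?_ (norm_nonneg _)
    refine (norm_mul_le_right_of_forall_le_one hle _ _).trans ?_
    rw [norm_pow]
    exact pow_le_pow_of_le_one (norm_nonneg _) he.le hlt
  rw [← neg_eq_iff_add_eq_zero] at h0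
  rw [← h0, norm_neg, norm_mul, norm_mul, norm_coeff_eq_one hle hα, one_mul, norm_pow,
    pow_succ] at h1
  have h2 : 0 < ‖a‖ * ‖e‖ ^ J α := mul_pos (norm_pos_iff.2 ha) (pow_pos (norm_pos_iff.2 he0) _)
  nlinarith

variable [CompleteSpace R]

lemma evalAt_mul (hle : ∀ x : R, ‖x‖ ≤ 1) {u : R} (hu : ‖u‖ < 1) (F G : PowerSeries k) :
    evalAt c u (F * G) = evalAt c u F * evalAt c u G := by
  rw [evalAt, evalAt, evalAt, tsum_mul_tsum_eq_tsum_sum_antidiagonal_of_summable_norm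
    (summable_norm_mul_pow hle hu _) (summable_norm_mul_pow hle hu _)]
  refine tsum_congr fun n => ?_
  rw [PowerSeries.coeff_mul, map_sum, Finset.sum_mul]
  refine Finset.sum_congr rfl fun ij hij => ?_
  rw [← Finset.HasAntidiagonal.mem_antidiagonal.1 hij, map_mul, pow_add]
  ring

lemma evalAt_pow (hle : ∀ x : R, ‖x‖ ≤ 1) {u : R} (hu : ‖u‖ < 1) (F : PowerSeries k) (n : ℕ) :
    evalAt c u (F ^ n) = evalAt c u F ^ n := by
  induction n with
  | zero => simp [evalAt_one]
  | succ n ih => rw [pow_succ, pow_succ, evalAt_mul hle hu, ih]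

lemma evalAt₂_eq_tsum (hle : ∀ x : R, ‖x‖ ≤ 1) {u b : R} (hu : ‖u‖ < 1) (hb : ‖b‖ < 1)
    (f : ℕ → PowerSeries k) : evalAt₂ c u b f = ∑' j, evalAt c u (f j) * b ^ j := by
  have h1 := (summable_norm_mul_pow₂ hle hu hb
    (fun α => c (PowerSeries.coeff α.1 (f α.2)))).of_norm
  rw [evalAt₂, ← (Equiv.prodComm ℕ ℕ).tsum_eq]
  refine (((Equiv.prodComm ℕ ℕ).summable_iff.2 h1).tsum_prod).trans ?_
  refine tsum_congr fun j => ?_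
  rw [evalAt, ← (summable_norm_mul_pow hle hu _).of_norm.tsum_mul_right]
  rfl

/-- Multiplying the second argument by `W(u)` amounts to multiplying the coefficient of `b^j` by
`W^j`. -/
lemma evalAt₂_mul_evalAt (hle : ∀ x : R, ‖x‖ ≤ 1) {u b : R} (hu : ‖u‖ < 1) (hb : ‖b‖ < 1)
    (W : PowerSeries k) (f : ℕ → PowerSeries k) :
    evalAt₂ c u (b * evalAt c u W) f = evalAt₂ c u b fun j => f j * W ^ j := by
  have hb' : ‖b * evalAt c u W‖ < 1 := by
    rw [mul_comm]; exact (norm_mul_le_right_of_forall_le_one hle _ _).trans_lt hb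
  rw [evalAt₂_eq_tsum hle hu hb, evalAt₂_eq_tsum hle hu hb']
  refine tsum_congr fun j => ?_
  rw [evalAt_mul hle hu, evalAt_pow hle hu, mul_pow]
  ring

lemma evalAt_ne_zero [IsUltrametricDist R] (hle : ∀ x : R, ‖x‖ ≤ 1) {u : R} (hu0 : u ≠ 0) (hu : ‖u‖ < 1)
    {F : PowerSeries k} (hF : F ≠ 0) : evalAt c u F ≠ 0 := by
  intro h
  refine hF (PowerSeries.ext fun i => ?_)
  refine congrFun (coeff_eq_zero_of_tsum_mul_pow_eq_zero (c := c) hle one_ne_zero hu0 hu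
    (x := fun i => PowerSeries.coeff i F) (J := id) (fun _ _ _ _ h => h) ?_ ?_) i
  · simpa using (summable_norm_mul_pow hle hu fun i => c (PowerSeries.coeff i F)).of_norm
  · simpa [evalAt] using h

end PowerSeriesEval

/-! ### Analytic independence -/

section Independence

variable {R : Type*} [NormedCommRing R] [NormMulClass R] [IsDomain R] [IsUltrametricDist R]
  [CompleteSpace R] {k : Type*} [Field k] {c : k →+* R}

/-- The case `F = X ^ d` of `eq_zero_of_evalAt₂_eq_zero`: since `σ` fixes `k` and `e = u^d b` and
multiplies `u` by `q`, it multiplies `u^i b^j` by `q^(i - dj)`. -/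
lemma eq_zero_of_evalAt₂_eq_zero_of_pow_mul_eq (p : ℕ) [Fact p.Prime] [CharP R p]
    (hle : ∀ x : R, ‖x‖ ≤ 1) {q : Rˣ} (hq1 : q ≠ 1)
    (hq : ‖(q : R) - 1‖ < 1) {σ : R →+* R} (hσ : Continuous σ) (hσq : Units.map (σ : R →* R) q = q)
    (hσc : ∀ x, σ (c x) = c x) {u b e : R} (hσu : σ u = q * u) (hσe : σ e = e) (hu : ‖u‖ < 1)
    (hb : ‖b‖ < 1) (he0 : e ≠ 0) {d : ℕ} (hub : u ^ d * b = e) {f : ℕ → PowerSeries k}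
    (h0 : evalAt₂ c u b f = 0) (hu0 : u ≠ 0) : f = 0 := by
  have hσb : σ b = ((q ^ (-(d : ℤ)) : Rˣ) : R) * b := by
    have h1 : ((q ^ d : Rˣ) : R) * σ b = b := by
      have h2 : σ (u ^ d * b) = u ^ d * b := by rw [hub, hσe]
      rw [map_mul, map_pow, hσu, mul_pow] at h2
      refine mul_left_cancel₀ (pow_ne_zero d hu0) ?_
      rw [← h2, Units.val_pow_eq_pow_val]
      ring
    rw [zpow_neg, zpow_natCast, Units.eq_inv_mul_iff_mul_eq]
    exact h1
  have he : ‖e‖ < 1 := by rw [← hub]; exact (norm_mul_le_right_of_forall_le_one hle _ _).trans_lt hb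
  have hs := summable_norm_mul_pow₂ hle hu hb fun α => c (PowerSeries.coeff α.1 (f α.2))
  have hterm : ∀ α : ℕ × ℕ, σ (c (PowerSeries.coeff α.1 (f α.2)) * u ^ α.1 * b ^ α.2) =
      ((q ^ ((α.1 : ℤ) - d * α.2) : Rˣ) : R) *
        (c (PowerSeries.coeff α.1 (f α.2)) * u ^ α.1 * b ^ α.2) := by
    intro α
    have h1 : q ^ ((α.1 : ℤ) - d * α.2) = q ^ α.1 * (q ^ (-(d : ℤ))) ^ α.2 := by
      rw [← zpow_natCast, ← zpow_natCast, ← zpow_mul, ← zpow_add]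
      congr 1
      ring
    rw [map_mul, map_mul, hσc, map_pow, map_pow, hσu, hσb, h1, Units.val_mul,
      Units.val_pow_eq_pow_val, Units.val_pow_eq_pow_val]
    ring
  funext j₀
  ext i₀
  have h1 := tsum_eigenspace_eq_zero p hle hq1 hq hσ hσq hs
    (fun α => (α.1 : ℤ) - d * α.2) hterm h0 ((i₀ : ℤ) - d * j₀)
  let x : ℕ × ℕ → k := fun α =>
    if (α.1 : ℤ) - d * α.2 = (i₀ : ℤ) - d * j₀ then PowerSeries.coeff α.1 (f α.2) else 0
  -- The monomials of weight `i₀ - d j₀`, multiplied by `u^(d j₀)`, are `u^i₀` times powers of `e`.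
  have h2 : ∀ α : ℕ × ℕ, (if (α.1 : ℤ) - d * α.2 = (i₀ : ℤ) - d * j₀ then
      c (PowerSeries.coeff α.1 (f α.2)) * u ^ α.1 * b ^ α.2 else 0) * u ^ (d * j₀) =
      u ^ i₀ * (c (x α) * e ^ α.2) := by
    intro α
    simp only [x]
    split_ifs with h
    · have h3 : α.1 + d * j₀ = i₀ + d * α.2 := by zify; linarith
      have h4 : u ^ α.1 * u ^ (d * j₀) = u ^ i₀ * u ^ (d * α.2) := by
        rw [← pow_add, ← pow_add, h3]
      rw [← hub, mul_pow, ← pow_mul]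
      linear_combination (c (PowerSeries.coeff α.1 (f α.2)) * b ^ α.2) * h4
    · simp
  have hs' : Summable fun α => u ^ i₀ * (c (x α) * e ^ α.2) := by
    simp_rw [← h2]
    exact (summable_norm_ite hs _).of_norm.mul_right _
  have h5 : ∑' α, u ^ i₀ * (c (x α) * e ^ α.2) = 0 := by
    simp_rw [← h2]
    rw [(summable_norm_ite hs _).of_norm.tsum_mul_right, h1, zero_mul]
  have h6 := coeff_eq_zero_of_tsum_mul_pow_eq_zero hle (pow_ne_zero i₀ hu0) he0 he
    (x := x) (J := Prod.snd) (fun α β hα hβ hαβ => ?_) hs' h5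
  · have h7 := congrFun h6 (i₀, j₀)
    simpa [x] using h7
  · have hα' := (ite_ne_right_iff.1 hα).1
    have hβ' := (ite_ne_right_iff.1 hβ).1
    rw [hαβ] at hα'
    exact Prod.ext (by omega) hαβ

/-- Analytic independence over `k` of `u` and `b = e / F(u)`, where a continuous ring endomorphism
`σ` fixes `k` and `e` and multiplies `u` by a unit `q ≠ 1` close to `1`. -/
lemma eq_zero_of_evalAt₂_eq_zero (p : ℕ) [Fact p.Prime] [CharP R p]
    (hle : ∀ x : R, ‖x‖ ≤ 1) {q : Rˣ} (hq1 : q ≠ 1)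
    (hq : ‖(q : R) - 1‖ < 1) {σ : R →+* R} (hσ : Continuous σ) (hσq : Units.map (σ : R →* R) q = q)
    (hσc : ∀ x, σ (c x) = c x) {u b e : R} (hσu : σ u = q * u) (hσe : σ e = e) (hu0 : u ≠ 0)
    (hu : ‖u‖ < 1) (hb : ‖b‖ < 1) (he0 : e ≠ 0) {F : PowerSeries k} (hF : F ≠ 0)
    (hub : b * evalAt c u F = e) {f : ℕ → PowerSeries k} (h0 : evalAt₂ c u b f = 0) : f = 0 := by
  obtain ⟨U, hU⟩ := PowerSeries.isUnit_divided_by_X_pow_order hF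
  set d := F.order.toNat
  have hFU : PowerSeries.X ^ d * (U : PowerSeries k) = F := by
    rw [hU]; exact PowerSeries.X_pow_order_mul_divXPowOrder
  have hUW : evalAt c u (U : PowerSeries k) * evalAt c u ((U⁻¹ : (PowerSeries k)ˣ) : PowerSeries k)
      = 1 := by
    rw [← evalAt_mul hle hu, Units.mul_inv, evalAt_one]
  have hb' : ‖b * evalAt c u (U : PowerSeries k)‖ < 1 := by
    rw [mul_comm]; exact (norm_mul_le_right_of_forall_le_one hle _ _).trans_lt hb
  have hbW : b * evalAt c u (U : PowerSeries k) *
      evalAt c u ((U⁻¹ : (PowerSeries k)ˣ) : PowerSeries k) = b := by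
    rw [mul_assoc, hUW, mul_one]
  rw [← hbW, evalAt₂_mul_evalAt hle hu hb'] at h0
  have h1 := eq_zero_of_evalAt₂_eq_zero_of_pow_mul_eq p hle hq1 hq hσ hσq hσc hσu hσe hu hb' he0
    (d := d) (by rw [← hub, ← hFU, evalAt_mul hle hu, evalAt_X_pow]; ring) h0 hu0
  funext j
  have h2 := congrFun h1 j
  simp only [Pi.zero_apply] at h2 ⊢
  exact (mul_eq_zero.1 h2).resolve_right (pow_ne_zero _ (Units.ne_zero _))

/-- If `k` is finite, then analytic independence of `u` and `b` is effective, as the space of power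
series over `k` is compact. -/
lemma exists_pos_forall_norm_evalAt₂_lt [Finite k] (hle : ∀ x : R, ‖x‖ ≤ 1) {u b : R}
    (hu : ‖u‖ < 1) (hb : ‖b‖ < 1) (hinj : ∀ f : ℕ → PowerSeries k, evalAt₂ c u b f = 0 → f = 0)
    (n : ℕ) : ∃ δ : ℝ, 0 < δ ∧ ∀ f : ℕ → PowerSeries k, ‖evalAt₂ c u b f‖ < δ →
      ∀ i j, i ≤ n → j ≤ n → PowerSeries.coeff i (f j) = 0 := by
  have : NormOneClass R := NormMulClass.toNormOneClass
  by_contra! hcon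
  choose f hf i j hi hj hij using fun m : ℕ => hcon (1 / ((m : ℝ) + 1)) (by positivity)
  let 𝒰 : Ultrafilter ℕ := hyperfilter ℕ
  -- The limit of the counterexamples `f m` along an ultrafilter.
  have hlim : ∀ α : ℕ × ℕ, ∃ x : k, ∀ᶠ m in (𝒰 : Filter ℕ), PowerSeries.coeff α.1 (f m α.2) = x :=
    fun α => by
      have h1 : ∀ᶠ m in (𝒰 : Filter ℕ), ∃ x ∈ (Set.univ : Set k),
        PowerSeries.coeff α.1 (f m α.2) = x := by simp
      obtain ⟨x, -, hx⟩ := (Ultrafilter.eventually_exists_mem_iff Set.finite_univ).1 h1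
      exact ⟨x, hx⟩
  choose g hg using hlim
  have hg0 : evalAt₂ c u b (fun j => PowerSeries.mk fun i => g (i, j)) = 0 := by
    rw [← norm_le_zero_iff]
    refine le_of_forall_pos_le_add fun ε hε => ?_
    rw [zero_add]
    have hsum : Summable fun α : ℕ × ℕ => ‖(1 : R) * u ^ α.1 * b ^ α.2‖ :=
      summable_norm_mul_pow₂ hle hu hb _
    have hfin : {α : ℕ × ℕ | ¬ ‖(1 : R) * u ^ α.1 * b ^ α.2‖ < ε}.Finite :=
      hsum.tendsto_cofinite_zero.eventually (gt_mem_nhds hε)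
    have h1 : ∀ᶠ m in (𝒰 : Filter ℕ), ∀ α ∈ {α : ℕ × ℕ | ¬ ‖(1 : R) * u ^ α.1 * b ^ α.2‖ < ε},
        PowerSeries.coeff α.1 (f m α.2) = g α :=
      (hfin.eventually_all).2 fun α _ => hg α
    have h2 : ∀ᶠ m : ℕ in (𝒰 : Filter ℕ), 1 / ((m : ℝ) + 1) < ε :=
      Nat.hyperfilter_le_atTop
        (tendsto_one_div_add_atTop_nhds_zero_nat.eventually (gt_mem_nhds hε))
    obtain ⟨m, hm1, hm2⟩ := (h1.and h2).exists
    have h3 : ‖evalAt₂ c u b (fun j => PowerSeries.mk fun i => g (i, j)) -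
        evalAt₂ c u b (f m)‖ ≤ ε := by
      rw [evalAt₂, evalAt₂, ← (summable_norm_mul_pow₂ hle hu hb _).of_norm.tsum_sub
        (summable_norm_mul_pow₂ hle hu hb _).of_norm]
      refine IsUltrametricDist.norm_tsum_le_of_forall_le fun α => ?_
      rw [PowerSeries.coeff_mk]
      by_cases hα : ‖(1 : R) * u ^ α.1 * b ^ α.2‖ < ε
      · rw [one_mul] at hα
        rw [mul_assoc, mul_assoc, ← sub_mul]
        exact (norm_mul_le_right_of_forall_le_one hle _ _).trans hα.le
      · rw [hm1 α hα, sub_self, norm_zero]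
        exact hε.le
    rw [← sub_add_cancel (evalAt₂ c u b fun j => PowerSeries.mk fun i => g (i, j))
      (evalAt₂ c u b (f m))]
    exact (IsUltrametricDist.norm_add_le_max _ _).trans (max_le h3 ((hf m).trans hm2).le)
  have hg1 : ∀ α, g α = 0 := fun α => by
    have h1 := congrArg (PowerSeries.coeff α.1) (congrFun (hinj _ hg0) α.2)
    simpa using h1
  have hfin : ((Set.Iic n) ×ˢ (Set.Iic n) : Set (ℕ × ℕ)).Finite :=
    (Set.finite_Iic n).prod (Set.finite_Iic n)
  obtain ⟨m, hm⟩ := ((hfin.eventually_all).2 fun α _ => hg α).exists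
  exact hij m ((hm (i m, j m) ⟨hi m, hj m⟩).trans (hg1 _))

end Independence

/-! ### The norm on the ring of integers of the tilt -/

section TiltNorm

variable {p : ℕ} [Fact p.Prime]

lemma mk_eq_zero_iff (a : 𝓞_ℂ_[p]) :
    (Ideal.Quotient.mk _ a : ModP 𝓞_ℂ_[p] p) = 0 ↔ Valued.v (a : ℂ_[p]) ≤ (1 / p : ℝ≥0) := by
  have h := ModP.v_p_lt_val (PadicComplexInt.integers p) (p := p) (x := a)
  rw [← not_iff_not, not_le, ← PadicComplex.valuation_p]
  exact h.symm

/-- The absolute value of an element of the tilt is read off any of its nonzero coordinates. -/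
lemma tiltAbsInt_eq {x : OCpFlat p} {n : ℕ} {a : 𝓞_ℂ_[p]}
    (hx : PreTilt.coeff n x = Ideal.Quotient.mk _ a) (h0 : PreTilt.coeff n x ≠ 0) :
    tiltAbsInt p x = Valued.v (a : ℂ_[p]) ^ p ^ n := by
  have h1 : tiltAbsInt p x = _ := PreTilt.valAux_eq (PadicComplexInt.integers p) h0
  rw [h1, hx, ModP.preVal_mk (PadicComplexInt.integers p) (hx ▸ h0)]
  rfl

lemma exists_coeff_ne_zero {x : OCpFlat p} (hx : x ≠ 0) : ∃ n, ∀ m, n ≤ m →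
    PreTilt.coeff m x ≠ 0 := by
  obtain ⟨n, hn⟩ : ∃ n, PreTilt.coeff n x ≠ 0 := not_forall.1 fun h => hx (Perfection.ext h)
  exact ⟨n, fun m hm => Perfection.coeff_ne_zero_of_le hn hm⟩

lemma coeff_pow_pow (x : OCpFlat p) (n k : ℕ) :
    PreTilt.coeff (n + k) x ^ p ^ k = PreTilt.coeff n x :=
  Perfection.coeffMonoidHom_pow_p_pow' x n k

lemma coeff_eq_zero_iff (x : OCpFlat p) (n : ℕ) :
    PreTilt.coeff n x = 0 ↔ tiltAbsInt p x ≤ (1 / p : ℝ≥0) ^ p ^ n := by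
  have hp : p ≠ 0 := (Fact.out : p.Prime).ne_zero
  constructor
  · intro h
    by_cases hx : x = 0
    · simp [hx]
    obtain ⟨m, hm⟩ := exists_coeff_ne_zero hx
    obtain ⟨a, ha⟩ := Ideal.Quotient.mk_surjective (PreTilt.coeff (n + m) x)
    rw [tiltAbsInt_eq ha.symm (hm _ (Nat.le_add_left _ _)), pow_add, mul_comm, pow_mul]
    refine pow_le_pow_left' ?_ _
    rw [← map_pow]
    refine (mk_eq_zero_iff (a ^ p ^ m)).1 ?_
    rw [map_pow, ha, coeff_pow_pow, h]
  · intro h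
    by_contra h0
    obtain ⟨a, ha⟩ := Ideal.Quotient.mk_surjective (PreTilt.coeff n x)
    rw [tiltAbsInt_eq ha.symm h0] at h
    refine h0 (ha ▸ (mk_eq_zero_iff a).2 ?_)
    exact (pow_le_pow_iff_left₀ zero_le zero_le (pow_ne_zero _ hp)).1 h

lemma tiltAbsInt_le_one (x : OCpFlat p) : tiltAbsInt p x ≤ 1 := by
  by_cases hx : x = 0
  · simp [hx]
  obtain ⟨m, hm⟩ := exists_coeff_ne_zero hx
  obtain ⟨a, ha⟩ := Ideal.Quotient.mk_surjective (PreTilt.coeff m x)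
  rw [tiltAbsInt_eq ha.symm (hm _ le_rfl)]
  exact pow_le_one' a.2 _

lemma tiltAbsInt_eq_zero {x : OCpFlat p} : tiltAbsInt p x = 0 ↔ x = 0 :=
  PreTilt.map_eq_zero (PadicComplexInt.integers p)

lemma exists_one_div_pow_lt {ε : ℝ≥0} (hε : 0 < ε) : ∃ n : ℕ, (1 / p : ℝ≥0) ^ p ^ n < ε := by
  have hp := (Fact.out : p.Prime).one_lt
  have h1 : (1 / p : ℝ≥0) < 1 := by
    rw [one_div]
    exact inv_lt_one_of_one_lt₀ (by exact_mod_cast hp)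
  obtain ⟨n, hn⟩ := exists_pow_lt_of_lt_one hε h1
  exact ⟨n, (pow_le_pow_of_le_one zero_le h1.le (Nat.lt_pow_self hp).le).trans_lt hn⟩

/-- The element of the tilt given by a root-compatible sequence has the absolute value of the
first term of the sequence. -/
lemma tiltAbsInt_ofRoots (x : ℕ → 𝓞_ℂ_[p]) (hx : ∀ n, x (n + 1) ^ p = x n) (h0 : x 0 ≠ 0) :
    tiltAbsInt p (ofRoots x hx) = Valued.v (x 0 : ℂ_[p]) := by
  have hpow : ∀ n, x n ^ p ^ n = x 0 := fun n => by
    induction n with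
    | zero => simp
    | succ n ih => rw [pow_succ', pow_mul, hx, ih]
  have hpow' : ∀ n, Valued.v (x n : ℂ_[p]) ^ p ^ n = Valued.v (x 0 : ℂ_[p]) := fun n => by
    rw [← map_pow, ← hpow n]; rfl
  have hv : 0 < Valued.v (x 0 : ℂ_[p]) := by
    rw [zero_lt_iff, Valuation.ne_zero_iff]
    exact fun h => h0 (Subtype.ext h)
  obtain ⟨n, hn⟩ := exists_one_div_pow_lt (p := p) hv
  have h1 : PreTilt.coeff n (ofRoots x hx) = Ideal.Quotient.mk _ (x n) := rfl
  rw [tiltAbsInt_eq h1, hpow']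
  rw [h1, Ne, mk_eq_zero_iff]
  intro h
  rw [← hpow' n] at hn
  exact absurd (pow_le_pow_left' h _) hn.not_ge

/-- The norm `|x^♯|` on `𝒪_{ℂ_p}^♭`. -/
instance : NormedCommRing (OCpFlat p) where
  __ := (inferInstance : CommRing (OCpFlat p))
  norm x := (tiltAbsInt p x : ℝ)
  dist x y := (tiltAbsInt p (x - y) : ℝ)
  dist_self x := by simp
  dist_comm x y := by rw [← Valuation.map_neg, neg_sub]
  dist_triangle x y z := by
    rw [← sub_add_sub_cancel x y z]
    exact_mod_cast ((tiltAbsInt p).map_add _ _).trans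
      (max_le (le_add_of_nonneg_right zero_le) (le_add_of_nonneg_left zero_le))
  eq_of_dist_eq_zero {x y} h := by
    rw [NNReal.coe_eq_zero, tiltAbsInt_eq_zero] at h
    exact sub_eq_zero.1 h
  dist_eq x y := by
    rw [← Valuation.map_neg]
    congr 2
    ring
  norm_mul_le x y := by
    rw [map_mul, NNReal.coe_mul]

lemma norm_eq_tiltAbsInt (x : OCpFlat p) : ‖x‖ = tiltAbsInt p x := rfl

lemma normMulClass_tilt (p : ℕ) [Fact p.Prime] : NormMulClass (OCpFlat p) where
  norm_mul x y := by simp [norm_eq_tiltAbsInt]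

attribute [local instance] normMulClass_tilt

instance : IsUltrametricDist (OCpFlat p) :=
  IsUltrametricDist.isUltrametricDist_of_forall_norm_add_le_max_norm fun x y => by
    simp only [norm_eq_tiltAbsInt]
    exact_mod_cast (tiltAbsInt p).map_add x y

lemma norm_le_one_tilt (x : OCpFlat p) : ‖x‖ ≤ 1 := by
  rw [norm_eq_tiltAbsInt]
  exact_mod_cast tiltAbsInt_le_one x

lemma coeff_eq_iff_norm_sub_le (x y : OCpFlat p) (n : ℕ) :
    PreTilt.coeff n x = PreTilt.coeff n y ↔ ‖x - y‖ ≤ ((1 / p : ℝ≥0) ^ p ^ n : ℝ≥0) := by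
  rw [← sub_eq_zero, ← map_sub, coeff_eq_zero_iff, norm_eq_tiltAbsInt, NNReal.coe_le_coe]

instance : CompleteSpace (OCpFlat p) := by
  refine Metric.complete_of_cauchySeq_tendsto fun s hs => ?_
  have hp : (0 : ℝ≥0) < 1 / p := by
    have := (Fact.out : p.Prime).pos
    positivity
  have h1 : ∀ n : ℕ, ∃ N, ∀ m, N ≤ m → PreTilt.coeff n (s m) = PreTilt.coeff n (s N) := by
    intro n
    obtain ⟨N, hN⟩ := Metric.cauchySeq_iff'.1 hs (((1 / p : ℝ≥0) ^ p ^ n : ℝ≥0) : ℝ)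
      (by exact_mod_cast pow_pos hp _)
    exact ⟨N, fun m hm => (coeff_eq_iff_norm_sub_le _ _ _).2
      ((dist_eq_norm (s m) (s N)) ▸ (hN m hm).le)⟩
  choose N hN using h1
  have hN' : ∀ n m, N n ≤ m → PreTilt.coeff n (s m) = PreTilt.coeff n (s (N n)) := hN
  let y : OCpFlat p := ⟨fun n => PreTilt.coeff n (s (N n)), fun n => by
    change PreTilt.coeff (n + 1) (s (N (n + 1))) ^ p = PreTilt.coeff n (s (N n))
    rw [← hN' (n + 1) _ (le_max_right (N n) _), ← hN' n _ (le_max_left _ (N (n + 1))),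
      PreTilt.coeff_pow_p]⟩
  refine ⟨y, Metric.tendsto_atTop.2 fun ε hε => ?_⟩
  lift ε to ℝ≥0 using hε.le
  obtain ⟨n, hn⟩ := exists_one_div_pow_lt (p := p) (ε := ε) (by exact_mod_cast hε)
  refine ⟨N n, fun m hm => ?_⟩
  rw [dist_eq_norm]
  refine lt_of_le_of_lt ((coeff_eq_iff_norm_sub_le _ _ n).1 ?_) (NNReal.coe_lt_coe.2 hn)
  exact hN' n m hm

lemma dvd_of_tiltAbsInt_le_of_coeff_ne_zero {x y : OCpFlat p} (hy : PreTilt.coeff 0 y ≠ 0)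
    (h : tiltAbsInt p x ≤ tiltAbsInt p y) : y ∣ x := by
  have hp := (Fact.out : p.Prime)
  have hy' : ∀ n, PreTilt.coeff n y ≠ 0 := fun n => Perfection.coeff_ne_zero_of_le hy (zero_le)
  have hint := PadicComplexInt.integers p
  have hv1 : ∀ a : 𝓞_ℂ_[p], Valued.v (a : ℂ_[p]) ≤ 1 := fun a => a.2
  choose b hb using fun n => Ideal.Quotient.mk_surjective (PreTilt.coeff n y)
  -- Quotients `c n` of lifts of the coordinates are compatible under `p`-th powers, up to an
  -- error whose `p`-th power is divisible by `p`.
  have hc : ∀ n, ∃ c, Ideal.Quotient.mk _ (b n * c) = PreTilt.coeff n x := by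
    intro n
    by_cases h0 : PreTilt.coeff n x = 0
    · exact ⟨0, by rw [mul_zero, map_zero, h0]⟩
    obtain ⟨a, ha⟩ := Ideal.Quotient.mk_surjective (PreTilt.coeff n x)
    rw [tiltAbsInt_eq ha.symm h0, tiltAbsInt_eq (hb n).symm (hy' n),
      pow_le_pow_iff_left₀ zero_le zero_le (pow_ne_zero _ hp.ne_zero)] at h
    obtain ⟨c, rfl⟩ := hint.le_iff_dvd.1 h
    exact ⟨c, ha⟩
  choose c hc using hc
  have hδ : ∀ n, Valued.v ((c (n + 1) ^ p - c n : 𝓞_ℂ_[p]) : ℂ_[p]) * Valued.v (b n : ℂ_[p])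
      ≤ (1 / p : ℝ≥0) := by
    intro n
    rw [← map_mul]
    refine (mk_eq_zero_iff ((c (n + 1) ^ p - c n) * b n)).1 ?_
    have h1 : (Ideal.Quotient.mk _ (b n) : ModP 𝓞_ℂ_[p] p) = Ideal.Quotient.mk _ (b (n + 1)) ^ p := by
      rw [hb, hb, PreTilt.coeff_pow_p]
    rw [sub_mul, map_sub, map_mul, map_pow, h1, ← mul_pow, ← map_mul, mul_comm (c (n + 1)), hc,
      mul_comm, hc, PreTilt.coeff_pow_p, sub_self]
  have hb2 : ∀ n, (1 / p : ℝ≥0) < Valued.v (b (n + 1) : ℂ_[p]) ^ 2 := by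
    intro n
    refine lt_of_lt_of_le ?_ (pow_le_pow_of_le_one zero_le (hv1 _) hp.two_le)
    by_contra! h1
    rw [← map_pow] at h1
    have h2 := (mk_eq_zero_iff (b (n + 1) ^ p)).2 h1
    rw [map_pow, hb, PreTilt.coeff_pow_p] at h2
    exact hy' n h2
  have hδp : ∀ n, (Ideal.Quotient.mk _ (c (n + 2) ^ p - c (n + 1)) : ModP 𝓞_ℂ_[p] p) ^ p = 0 := by
    intro n
    rw [← map_pow, mk_eq_zero_iff]
    have h1 := hδ (n + 1)
    have h2 := hb2 n
    set δ := c (n + 2) ^ p - c (n + 1)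
    have h3 : Valued.v (δ : ℂ_[p]) ^ 2 ≤ (1 / p : ℝ≥0) := by
      by_contra! h4
      have h5 := mul_lt_mul'' h4 h2 zero_le zero_le
      rw [← mul_pow, ← sq] at h5
      exact absurd (pow_le_pow_left' h1 2) h5.not_ge
    have h6 : Valued.v ((δ ^ p : 𝓞_ℂ_[p]) : ℂ_[p]) = Valued.v (δ : ℂ_[p]) ^ p := by
      rw [← map_pow]; rfl
    rw [h6]
    exact (pow_le_pow_of_le_one zero_le (hv1 _) hp.two_le).trans h3
  refine ⟨⟨fun n => Ideal.Quotient.mk _ (c (n + 1)) ^ p, fun n => ?_⟩, ?_⟩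
  · have h1 := hδp n
    rw [map_sub, map_pow, sub_pow_char, sub_eq_zero] at h1
    exact h1
  · refine Perfection.ext fun n => ?_
    change PreTilt.coeff n x = PreTilt.coeff n y * Ideal.Quotient.mk _ (c (n + 1)) ^ p
    rw [← PreTilt.coeff_pow_p x, ← hc, ← PreTilt.coeff_pow_p y, ← hb, map_mul, mul_pow]

/-- `𝒪_{ℂ_p}^♭` is a valuation ring. -/
lemma dvd_of_tiltAbsInt_le {x y : OCpFlat p} (hy : y ≠ 0) (h : tiltAbsInt p x ≤ tiltAbsInt p y) :
    y ∣ x := by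
  obtain ⟨n, hn⟩ := exists_coeff_ne_zero hy
  obtain ⟨x', rfl⟩ := (bijective_iterateFrobenius (OCpFlat p) p n).2 x
  obtain ⟨y', rfl⟩ := (bijective_iterateFrobenius (OCpFlat p) p n).2 y
  rw [iterateFrobenius_def, iterateFrobenius_def] at *
  refine pow_dvd_pow_of_dvd (dvd_of_tiltAbsInt_le_of_coeff_ne_zero ?_ ?_) _
  · have h1 : PreTilt.coeff (0 + n) (y' ^ p ^ n) = PreTilt.coeff 0 y' :=
      Perfection.coeffMonoidHom_pow_p_pow y' 0 n
    rw [← h1]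
    exact hn _ (by omega)
  · rw [map_pow, map_pow] at h
    exact (pow_le_pow_iff_left₀ zero_le zero_le
      (pow_ne_zero _ (Fact.out : p.Prime).ne_zero)).1 h

/-! ### The valuation of the tilt and limits -/

lemma tiltAbs_ofInt (x : OCpFlat p) : tiltAbs p (ofInt x) = tiltAbsInt p x :=
  Valuation.extendToLocalization_apply_map_apply _ _ _ _

lemma ofInt_injective : Function.Injective (ofInt : OCpFlat p → CpFlat p) :=
  IsFractionRing.injective (OCpFlat p) (CpFlat p)

lemma tiltAbs_eq_zero {z : CpFlat p} : tiltAbs p z = 0 ↔ z = 0 := Valuation.zero_iff _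

lemma lt_vFlat_iff (C : ℝ) (z : CpFlat p) :
    (C : WithTop ℝ) < vFlat z ↔ (tiltAbs p z : ℝ) < (p : ℝ) ^ (-C) := by
  have hp : (1 : ℝ) < p := by exact_mod_cast (Fact.out : p.Prime).one_lt
  rw [vFlat]
  split_ifs with h
  · simp only [h, map_zero, NNReal.coe_zero, WithTop.coe_lt_top, true_iff]
    positivity
  · have h1 : (0 : ℝ) < tiltAbs p z := by
      rw [NNReal.coe_pos, zero_lt_iff, Ne, tiltAbs_eq_zero]
      exact h
    rw [WithTop.coe_lt_coe, lt_neg, Real.logb_lt_iff_lt_rpow hp h1]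

lemma zero_lt_vFlat_iff (z : CpFlat p) : 0 < vFlat z ↔ tiltAbs p z < 1 := by
  have h := lt_vFlat_iff 0 z
  rw [neg_zero, Real.rpow_zero] at h
  exact_mod_cast h

lemma exists_ofInt_eq {z : CpFlat p} (hz : tiltAbs p z ≤ 1) : ∃ x : OCpFlat p, ofInt x = z := by
  obtain ⟨a, b, hb, rfl⟩ := IsFractionRing.div_surjective (A := OCpFlat p) z
  have hb0 : b ≠ 0 := nonZeroDivisors.ne_zero hb
  have hb1 : algebraMap (OCpFlat p) (CpFlat p) b ≠ 0 := fun h =>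
    hb0 (ofInt_injective (h.trans (map_zero _).symm))
  have h1 : tiltAbs p (ofInt a) ≤ tiltAbs p (ofInt b) := by
    rw [map_div₀] at hz
    exact (div_le_one₀ (zero_lt_iff.2 (mt tiltAbs_eq_zero.1 hb1))).1 hz
  rw [tiltAbs_ofInt, tiltAbs_ofInt] at h1
  obtain ⟨c, rfl⟩ := dvd_of_tiltAbsInt_le hb0 h1
  refine ⟨c, ?_⟩
  rw [map_mul, mul_div_cancel_left₀ _ hb1]
  rfl

lemma isTiltLimit_ofInt {t : ℕ → OCpFlat p} {y : OCpFlat p} (h : Tendsto t atTop (𝓝 y)) :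
    IsTiltLimit (fun n => ofInt (t n)) (ofInt y) := by
  intro C
  have hp : (0 : ℝ) < p := by exact_mod_cast (Fact.out : p.Prime).pos
  filter_upwards [Metric.tendsto_nhds.1 h _ (Real.rpow_pos_of_pos hp (-C))] with n hn
  have h1 : ofInt (t n) - ofInt y = ofInt (t n - y) := (map_sub _ _ _).symm
  rw [lt_vFlat_iff, h1, tiltAbs_ofInt]
  exact hn

lemma IsTiltLimit.unique {s : ℕ → CpFlat p} {y z : CpFlat p} (hy : IsTiltLimit s y)
    (hz : IsTiltLimit s z) : y = z := by
  by_contra hne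
  have h1 : (0 : ℝ) < tiltAbs p (y - z) := by
    rw [NNReal.coe_pos, zero_lt_iff, Ne, tiltAbs_eq_zero, sub_eq_zero]
    exact hne
  have hp : (1 : ℝ) < p := by exact_mod_cast (Fact.out : p.Prime).one_lt
  obtain ⟨n, hn1, hn2⟩ := ((hy (-Real.logb p (tiltAbs p (y - z)))).and
    (hz (-Real.logb p (tiltAbs p (y - z))))).exists
  rw [lt_vFlat_iff, neg_neg, Real.rpow_logb (by linarith) hp.ne' h1, NNReal.coe_lt_coe] at hn1 hn2
  have h2 := (tiltAbs p).map_add (y - s n) (s n - z)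
  rw [sub_add_sub_cancel, ← Valuation.map_neg _ (y - s n), neg_sub] at h2
  exact absurd (h2.trans_lt (max_lt hn1 hn2)) (lt_irrefl _)

lemma tiltLim_eq {s : ℕ → CpFlat p} {y : CpFlat p} (hy : IsTiltLimit s y) : tiltLim s = y := by
  have h : ∃ y, IsTiltLimit s y := ⟨y, hy⟩
  rw [tiltLim, dif_pos h]
  exact h.choose_spec.unique hy

end TiltNorm

/-! ### Roots of a uniformizer over the cyclotomic tower -/

section Kummer

variable {p : ℕ} [Fact p.Prime] {K : IntermediateField ℚ_[p] (PadicAlgCl p)}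

lemma IsUniformizer.exists_norm_eq_zpow {π : K} (hπ : IsUniformizer K π) {x : K} (hx : x ≠ 0) :
    ∃ l : ℤ, ‖x‖ = ‖π‖ ^ l := by
  obtain ⟨h0, h1, hmax⟩ := hπ
  have hπ0 : 0 < ‖π‖ := norm_pos_iff.2 h0
  obtain ⟨l, hl1, hl2⟩ := exists_mem_Ico_zpow (norm_pos_iff.2 hx) ((one_lt_inv₀ hπ0).2 h1)
  have hy1 : 1 ≤ ‖x * π ^ l‖ := by
    rw [norm_mul, norm_zpow]
    rw [inv_zpow] at hl1
    have := mul_le_mul_of_nonneg_right hl1 (zpow_pos hπ0 l).le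
    rwa [inv_mul_cancel₀ (zpow_pos hπ0 l).ne'] at this
  have hy2 : ‖x * π ^ (l + 1)‖ < 1 := by
    rw [norm_mul, norm_zpow]
    rw [inv_zpow] at hl2
    have := mul_lt_mul_of_pos_right hl2 (zpow_pos hπ0 (l + 1))
    rwa [inv_mul_cancel₀ (zpow_pos hπ0 _).ne'] at this
  have hy3 := hmax _ hy2
  refine ⟨-l, ?_⟩
  rw [zpow_neg]
  refine eq_inv_of_mul_eq_one_left ?_
  rw [norm_mul, norm_zpow] at hy1 hy3
  refine le_antisymm ?_ hy1
  rw [zpow_add_one₀ hπ0.ne', ← mul_assoc] at hy3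
  exact (mul_le_iff_le_one_left hπ0).1 hy3

/-- `(1 + x)^p = 1 + x^p + p x r` with `r` integral. -/
lemma norm_one_add_pow_sub_le {x : PadicAlgCl p} (hx : ‖x‖ ≤ 1) :
    ‖(1 + x) ^ p - 1 - x ^ p‖ ≤ ‖(p : PadicAlgCl p)‖ * ‖x‖ := by
  let O : Subring (PadicAlgCl p) := (NormedField.valuation (K := PadicAlgCl p)).integer
  obtain ⟨r, hr⟩ := exists_add_pow_prime_eq (Fact.out : p.Prime) (1 : O) ⟨x, hx⟩
  have hr' := congrArg (Subtype.val : O → PadicAlgCl p) hr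
  have hr1 : ‖(r : PadicAlgCl p)‖ ≤ 1 := r.2
  push_cast at hr'
  rw [hr', one_pow, mul_one]
  have h1 : 1 + x ^ p + (p : PadicAlgCl p) * x * r - 1 - x ^ p = p * x * r := by ring
  rw [h1, norm_mul, norm_mul]
  exact mul_le_of_le_one_right (by positivity) hr1

lemma norm_natCast_p : ‖(p : PadicAlgCl p)‖ = (p : ℝ)⁻¹ := by
  rw [← map_natCast (algebraMap ℚ_[p] (PadicAlgCl p)), norm_algebraMap', Padic.norm_p]

lemma norm_natCast_p_lt_one : ‖(p : PadicAlgCl p)‖ < 1 := by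
  rw [norm_natCast_p]
  exact inv_lt_one_of_one_lt₀ (by exact_mod_cast (Fact.out : p.Prime).one_lt)

/-- `K` does not contain all roots of unity of `p`-power order: along a chain `ζ_{n+1}^p = ζ_n` of
such roots in `K`, the absolute values of the `ζ_n - 1` would grow at least geometrically, as those
of the elements of the maximal ideal are bounded away from `1`. -/
lemma IsUniformizer.exists_pow_eq_one_notMem {π : K} (hπ : IsUniformizer K π) :
    ∃ (ζ : PadicAlgCl p) (n : ℕ), ζ ^ p ^ n = 1 ∧ ζ ∉ K := by
  by_contra! hcon
  have hp := (Fact.out : p.Prime)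
  obtain ⟨ζ₀, hζ₀⟩ := HasEnoughRootsOfUnity.exists_primitiveRoot (PadicAlgCl p) p
  choose rt hrt using fun x : PadicAlgCl p => IsAlgClosed.exists_pow_nat_eq x hp.pos
  obtain ⟨ζ, hζz, hζ⟩ : ∃ ζ : ℕ → PadicAlgCl p, ζ 0 = ζ₀ ∧ ∀ n, ζ (n + 1) ^ p = ζ n :=
    ⟨fun n => rt^[n] ζ₀, rfl, fun n => by simp only [Function.iterate_succ_apply', hrt]⟩
  have hζz1 : ζ 0 ^ p = 1 := by rw [hζz, hζ₀.pow_eq_one]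
  have hζ1 : ∀ n, ζ n ^ p ^ (n + 1) = 1 := fun n => by
    induction n with
    | zero => simpa using hζz1
    | succ n ih => rw [pow_succ', pow_mul, hζ, ih]
  have hnorm : ∀ n, ‖ζ n‖ = 1 := fun n =>
    (pow_eq_one_iff_of_nonneg (norm_nonneg _) (pow_ne_zero (n + 1) hp.ne_zero)).1
      (by rw [← norm_pow, hζ1, norm_one])
  have hx1 : ∀ n, ‖ζ n - 1‖ ≤ 1 := fun n => by
    have h1 := IsUltrametricDist.norm_add_le_max (ζ n) (-1)
    rwa [hnorm, norm_neg, norm_one, max_self, ← sub_eq_add_neg] at h1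
  have hid : ∀ n, ‖ζ n - 1 - (ζ (n + 1) - 1) ^ p‖ ≤ ‖(p : PadicAlgCl p)‖ * ‖ζ (n + 1) - 1‖ :=
    fun n => by
      have h1 := norm_one_add_pow_sub_le (hx1 (n + 1))
      rwa [add_sub_cancel, hζ] at h1
  have hp1 := norm_natCast_p_lt_one (p := p)
  have hlt : ∀ n, ‖ζ n - 1‖ < 1 := by
    -- If `a^p` is congruent to an element of norm `< 1`, then `a` has norm `< 1`.
    have hstep : ∀ a b : PadicAlgCl p, ‖b‖ < 1 → ‖b - a ^ p‖ < 1 → ‖a‖ < 1 := by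
      intro a b hb hab
      have h1 := IsUltrametricDist.norm_add_le_max b (-(b - a ^ p))
      rw [norm_neg, ← sub_eq_add_neg, sub_sub_cancel, norm_pow] at h1
      exact (pow_lt_one_iff_of_nonneg (norm_nonneg _) hp.ne_zero).1
        (h1.trans_lt (max_lt hb hab))
    intro n
    induction n with
    | zero =>
      refine hstep _ 0 (by simp) ?_
      have h1 := norm_one_add_pow_sub_le (hx1 0)
      rw [add_sub_cancel, hζz1, sub_self] at h1
      exact h1.trans_lt (mul_lt_one_of_nonneg_of_lt_one_left (norm_nonneg _) hp1 (hx1 0))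
    | succ n ih =>
      exact hstep _ _ ih ((hid n).trans_lt
        (mul_lt_one_of_nonneg_of_lt_one_left (norm_nonneg _) hp1 (hx1 _)))
  have hle : ∀ n, ‖ζ n - 1‖ ≤ ‖π‖ := fun n =>
    hπ.2.2 ⟨ζ n - 1, sub_mem (hcon _ _ (hζ1 n)) (one_mem K)⟩ (hlt n)
  set c : ℝ := max ‖(p : PadicAlgCl p)‖ ‖π‖
  have hc0 : 0 ≤ c := le_max_of_le_left (norm_nonneg _)
  have hc1 : c < 1 := max_lt hp1 hπ.2.1
  have hc : ∀ n, ‖ζ n - 1‖ ≤ c * ‖ζ (n + 1) - 1‖ := by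
    intro n
    have h1 := IsUltrametricDist.norm_add_le_max (ζ n - 1 - (ζ (n + 1) - 1) ^ p)
      ((ζ (n + 1) - 1) ^ p)
    rw [sub_add_cancel] at h1
    refine h1.trans (max_le ((hid n).trans ?_) ?_)
    · exact mul_le_mul_of_nonneg_right (le_max_left _ _) (norm_nonneg _)
    · rw [norm_pow]
      refine (pow_le_pow_of_le_one (norm_nonneg _) (hx1 _) hp.two_le).trans ?_
      rw [sq]
      exact mul_le_mul_of_nonneg_right ((hle _).trans (le_max_right _ _)) (norm_nonneg _)
  have hcn : ∀ n, ‖ζ 0 - 1‖ ≤ c ^ n := by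
    have h1 : ∀ n, ‖ζ 0 - 1‖ ≤ c ^ n * ‖ζ n - 1‖ := by
      intro n
      induction n with
      | zero => simp
      | succ n ih =>
        refine ih.trans ?_
        rw [pow_succ, mul_assoc]
        exact mul_le_mul_of_nonneg_left (hc n) (pow_nonneg hc0 n)
    exact fun n => (h1 n).trans (mul_le_of_le_one_right (pow_nonneg hc0 n) (hx1 n))
  have h0 : ‖ζ 0 - 1‖ ≤ 0 :=
    ge_of_tendsto' (tendsto_pow_atTop_nhds_zero_of_lt_one hc0 hc1) hcn
  rw [norm_le_zero_iff, sub_eq_zero, hζz] at h0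
  exact hζ₀.ne_one hp.one_lt h0

lemma mem_of_forall_fixingSubgroup (L : IntermediateField ℚ_[p] (PadicAlgCl p)) {x : PadicAlgCl p}
    (h : ∀ σ ∈ L.fixingSubgroup, σ x = x) : x ∈ L := by
  rw [← InfiniteGalois.fixedField_fixingSubgroup L]
  exact fun σ => h σ σ.2

lemma norm_algEquiv (σ : PadicAlgCl p ≃ₐ[ℚ_[p]] PadicAlgCl p) (x : PadicAlgCl p) :
    ‖σ x‖ = ‖x‖ := by
  rw [← PadicAlgCl.spectralNorm_eq, ← PadicAlgCl.spectralNorm_eq]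
  exact (spectralNorm_eq_of_equiv σ x).symm

lemma mem_fixingSubgroup_cyclotomic {σ : PadicAlgCl p ≃ₐ[ℚ_[p]] PadicAlgCl p}
    (hK : σ ∈ K.fixingSubgroup) (hζ : ∀ ζ : PadicAlgCl p, (∃ n : ℕ, ζ ^ p ^ n = 1) → σ ζ = ζ) :
    σ ∈ (cyclotomic K).fixingSubgroup := by
  rw [← Subgroup.zpowers_le, ← IntermediateField.le_iff_le, cyclotomic]
  refine sup_le ?_ (IntermediateField.adjoin_le_iff.2 fun ζ hζ1 => ?_)
  · rwa [IntermediateField.le_iff_le, Subgroup.zpowers_le]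
  · rintro ⟨τ, hτ⟩
    obtain ⟨n, rfl⟩ := Subgroup.mem_zpowers_iff.1 hτ
    have h1 : σ ∈ MulAction.stabilizer (PadicAlgCl p ≃ₐ[ℚ_[p]] PadicAlgCl p) ζ := hζ ζ hζ1
    exact Subgroup.zpow_mem _ h1 n

/-- The extension `K(ζ_{p^∞}) / K` is abelian. -/
lemma comm_apply_of_mem_cyclotomic {σ τ : PadicAlgCl p ≃ₐ[ℚ_[p]] PadicAlgCl p}
    (hσ : σ ∈ K.fixingSubgroup) (hτ : τ ∈ K.fixingSubgroup) {x : PadicAlgCl p}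
    (hx : x ∈ cyclotomic K) : σ (τ x) = τ (σ x) := by
  have h1 : (σ⁻¹ * τ⁻¹ * σ * τ) ∈ (cyclotomic K).fixingSubgroup := by
    refine mem_fixingSubgroup_cyclotomic (mul_mem (mul_mem (mul_mem (inv_mem hσ) (inv_mem hτ)) hσ)
      hτ) fun ζ ⟨n, hn⟩ => ?_
    have : NeZero (p ^ n) := ⟨pow_ne_zero _ (Fact.out : p.Prime).ne_zero⟩
    have hζ0 : IsUnit ζ := IsUnit.of_pow_eq_one hn this.ne
    obtain ⟨a, ha⟩ := rootsOfUnity.integer_power_of_ringEquiv' (p ^ n) σ.toRingEquiv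
    obtain ⟨b, hb⟩ := rootsOfUnity.integer_power_of_ringEquiv' (p ^ n) τ.toRingEquiv
    have hζ : hζ0.unit ∈ rootsOfUnity (p ^ n) (PadicAlgCl p) := by
      rw [mem_rootsOfUnity]; ext; simpa using hn
    have ha' : σ ζ = ζ ^ a := by simpa using ha _ hζ
    have hb' : τ ζ = ζ ^ b := by simpa using hb _ hζ
    have h2 : σ (τ ζ) = τ (σ ζ) := by
      rw [ha', hb', map_zpow₀, map_zpow₀, ha', hb', ← zpow_mul, ← zpow_mul, mul_comm]
    change σ⁻¹ (τ⁻¹ (σ (τ ζ))) = ζ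
    rw [h2]
    change σ.symm (τ.symm (τ (σ ζ))) = ζ
    rw [AlgEquiv.symm_apply_apply, AlgEquiv.symm_apply_apply]
  have h3 : σ.symm (τ.symm (σ (τ x))) = x := (IntermediateField.mem_fixingSubgroup_iff _ _).1 h1 x hx
  rw [AlgEquiv.symm_apply_eq, AlgEquiv.symm_apply_eq] at h3
  exact h3

/-- The `p`-power roots of a uniformizer of `K` do not all lie in the abelian extension
`K(ζ_{p^∞})`. -/
lemma IsUniformizer.exists_notMem_cyclotomic {π : K} (hπ : IsUniformizer K π)
    {ϖ : ℕ → PadicAlgCl p} (hϖ₀ : ϖ 0 = π) (hϖ : ∀ n, ϖ (n + 1) ^ p = ϖ n) :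
    ∃ n, ϖ n ∉ cyclotomic K := by
  by_contra! hcon
  have hp := (Fact.out : p.Prime)
  have hπ0 : (π : PadicAlgCl p) ≠ 0 := fun h => hπ.1 (Subtype.ext h)
  have hpow : ∀ n, ϖ n ^ p ^ n = π := fun n => by
    induction n with
    | zero => simpa using hϖ₀
    | succ n ih => rw [pow_succ', pow_mul, hϖ, ih]
  obtain ⟨ζ, n, hζ1, hζK⟩ := hπ.exists_pow_eq_one_notMem
  have hN : p ^ n ≠ 0 := pow_ne_zero _ hp.ne_zero
  have : NeZero (p ^ n) := ⟨hN⟩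
  refine hζK (mem_of_forall_fixingSubgroup K fun τ hτ => ?_)
  obtain ⟨m, hm⟩ := rootsOfUnity.integer_power_of_ringEquiv' (p ^ n) τ.toRingEquiv
  have hm' : ∀ t : PadicAlgCl p, t ^ p ^ n = 1 → τ t = t ^ m := fun t ht => by
    have ht0 : IsUnit t := IsUnit.of_pow_eq_one ht hN
    have ht1 : ht0.unit ∈ rootsOfUnity (p ^ n) (PadicAlgCl p) := by
      rw [mem_rootsOfUnity]; ext; simpa using ht
    simpa using hm _ ht1
  have hϖn : ϖ n ≠ 0 := fun h => hπ0 (by rw [← hpow n, h, zero_pow hN])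
  -- As `τ` commutes with the conjugations, `ϖ_n^m / τ(ϖ_n)` lies in `K`.
  have hz : ϖ n ^ m / τ (ϖ n) ∈ K := by
    refine mem_of_forall_fixingSubgroup K fun σ hσ => ?_
    have hσπ : σ (π : PadicAlgCl p) = π := (IntermediateField.mem_fixingSubgroup_iff _ _).1 hσ _ π.2
    have ht : (σ (ϖ n) / ϖ n) ^ p ^ n = 1 := by
      rw [div_pow, ← map_pow, hpow, hσπ, div_self hπ0]
    have h1 := hm' _ ht
    have h2 := comm_apply_of_mem_cyclotomic hσ hτ (hcon n)
    rw [map_div₀, div_zpow, ← h2] at h1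
    have h3 : τ (ϖ n) ≠ 0 := (map_ne_zero τ).2 hϖn
    have h4 : σ (τ (ϖ n)) ≠ 0 := (map_ne_zero σ).2 h3
    have h5 : ϖ n ^ m ≠ 0 := zpow_ne_zero m hϖn
    rw [map_div₀, map_zpow₀]
    field_simp at h1 ⊢
    linear_combination -h1
  have hz0 : (⟨_, hz⟩ : K) ≠ 0 := fun h =>
    div_ne_zero (zpow_ne_zero m hϖn) ((map_ne_zero τ).2 hϖn) (congrArg Subtype.val h)
  obtain ⟨l, hl⟩ := hπ.exists_norm_eq_zpow hz0
  have hπn : 0 < ‖π‖ := norm_pos_iff.2 hπ.1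
  have hl' : ‖π‖ ^ (m - 1) = ‖π‖ ^ (l * (p ^ n : ℕ)) := by
    have h1 : ‖ϖ n ^ m / τ (ϖ n)‖ = ‖π‖ ^ l := hl
    have h2 : ‖ϖ n‖ ^ p ^ n = ‖π‖ := by rw [← norm_pow, hpow]; rfl
    have h3 : 0 < ‖ϖ n‖ := norm_pos_iff.2 hϖn
    rw [norm_div, norm_algEquiv, norm_zpow, div_eq_mul_inv, ← zpow_sub_one₀ h3.ne'] at h1
    rw [zpow_mul, ← h1, ← h2, ← zpow_natCast, ← zpow_mul, ← zpow_mul, mul_comm]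
  have hml : m - 1 = l * (p ^ n : ℕ) :=
    zpow_right_injective₀ hπn hπ.2.1.ne hl'
  rw [hm' ζ hζ1, ← sub_add_cancel m 1, hml, zpow_add_one₀ (IsUnit.of_pow_eq_one hζ1 hN).ne_zero,
    mul_comm l, zpow_mul, zpow_natCast, hζ1, one_zpow, one_mul]

end Kummer

/-! ### The Galois action on the tilt -/

section GaloisAction

attribute [local instance] normMulClass_tilt

variable {p : ℕ} [Fact p.Prime]

lemma norm_eq_valued (x : ℂ_[p]) : ‖x‖ = ((Valued.v x : ℝ≥0) : ℝ) := by
  rw [PadicComplex.norm_eq_norm, Valued.v.norm_def, PadicComplex.RankOne.hom_eq_embedding,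
    Valuation.embedding_restrict]

lemma isometry_algEquiv (σ : PadicAlgCl p ≃ₐ[ℚ_[p]] PadicAlgCl p) :
    Isometry (σ : PadicAlgCl p →+* PadicAlgCl p) :=
  AddMonoidHomClass.isometry_of_norm _ (norm_algEquiv σ)

/-- The continuous extension of an automorphism of `PadicAlgCl p` to `ℂ_p`. -/
def conjC (σ : PadicAlgCl p ≃ₐ[ℚ_[p]] PadicAlgCl p) : ℂ_[p] →+* ℂ_[p] :=
  (isometry_algEquiv σ).mapRingHom

lemma conjC_coe (σ : PadicAlgCl p ≃ₐ[ℚ_[p]] PadicAlgCl p) (x : PadicAlgCl p) :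
    conjC σ (x : ℂ_[p]) = (σ x : PadicAlgCl p) :=
  (isometry_algEquiv σ).mapRingHom_coe x

lemma isometry_conjC (σ : PadicAlgCl p ≃ₐ[ℚ_[p]] PadicAlgCl p) : Isometry (conjC σ) :=
  (isometry_algEquiv σ).isometry_mapRingHom

lemma valued_conjC (σ : PadicAlgCl p ≃ₐ[ℚ_[p]] PadicAlgCl p) (x : ℂ_[p]) :
    Valued.v (conjC σ x) = Valued.v x := by
  rw [← NNReal.coe_inj, ← norm_eq_valued, ← norm_eq_valued]
  exact (AddMonoidHomClass.isometry_iff_norm (conjC σ)).1 (isometry_conjC σ) x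

/-- The action of an automorphism of `PadicAlgCl p` on `𝒪_{ℂ_p}`. -/
def conjInt (σ : PadicAlgCl p ≃ₐ[ℚ_[p]] PadicAlgCl p) : 𝓞_ℂ_[p] →+* 𝓞_ℂ_[p] :=
  ((conjC σ).comp (PadicComplexInt p).subtype).codRestrict (PadicComplexInt p).toSubring
    fun x => (valued_conjC σ x).trans_le x.2

/-- The action of an automorphism of `PadicAlgCl p` on `𝒪_{ℂ_p} / p`. -/
def conjModP (σ : PadicAlgCl p ≃ₐ[ℚ_[p]] PadicAlgCl p) : ModP 𝓞_ℂ_[p] p →+* ModP 𝓞_ℂ_[p] p :=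
  Ideal.quotientMap _ (conjInt σ) (by
    rw [Ideal.span_singleton_le_iff_mem, Ideal.mem_comap, map_natCast]
    exact Ideal.mem_span_singleton_self _)

lemma conjModP_mk (σ : PadicAlgCl p ≃ₐ[ℚ_[p]] PadicAlgCl p) (x : 𝓞_ℂ_[p]) :
    conjModP σ (Ideal.Quotient.mk _ x) = Ideal.Quotient.mk _ (conjInt σ x) := rfl

/-- The action of an automorphism of `PadicAlgCl p` on `𝒪_{ℂ_p}^♭`. -/
def conjFlat (σ : PadicAlgCl p ≃ₐ[ℚ_[p]] PadicAlgCl p) : OCpFlat p →+* OCpFlat p :=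
  Perfection.map p (conjModP σ)

lemma coeff_conjFlat (σ : PadicAlgCl p ≃ₐ[ℚ_[p]] PadicAlgCl p) (x : OCpFlat p) (n : ℕ) :
    PreTilt.coeff n (conjFlat σ x) = conjModP σ (PreTilt.coeff n x) := rfl

lemma continuous_conjFlat (σ : PadicAlgCl p ≃ₐ[ℚ_[p]] PadicAlgCl p) : Continuous (conjFlat σ) := by
  have hp : (0 : ℝ≥0) < 1 / p := by
    have := (Fact.out : p.Prime).pos
    positivity
  rw [Metric.continuous_iff]
  intro y ε hε
  lift ε to ℝ≥0 using hε.le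
  obtain ⟨n, hn⟩ := exists_one_div_pow_lt (p := p) (ε := ε) (by exact_mod_cast hε)
  refine ⟨((1 / p : ℝ≥0) ^ p ^ n : ℝ≥0), by exact_mod_cast pow_pos hp _, fun x hx => ?_⟩
  rw [dist_eq_norm] at hx ⊢
  refine lt_of_le_of_lt ((coeff_eq_iff_norm_sub_le _ _ n).1 ?_) (NNReal.coe_lt_coe.2 hn)
  rw [coeff_conjFlat, coeff_conjFlat, (coeff_eq_iff_norm_sub_le _ _ n).2 hx.le]

lemma conjFlat_ofRoots (σ : PadicAlgCl p ≃ₐ[ℚ_[p]] PadicAlgCl p) (x : ℕ → 𝓞_ℂ_[p])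
    (hx : ∀ n, x (n + 1) ^ p = x n) :
    conjFlat σ (ofRoots x hx) =
      ofRoots (fun n => conjInt σ (x n)) fun n => by rw [← map_pow, hx] :=
  Perfection.ext fun _ => rfl

lemma ofRoots_mul (x y : ℕ → 𝓞_ℂ_[p]) (hx : ∀ n, x (n + 1) ^ p = x n)
    (hy : ∀ n, y (n + 1) ^ p = y n) :
    ofRoots x hx * ofRoots y hy = ofRoots (x * y) fun n => by simp [mul_pow, hx, hy] :=
  Perfection.ext fun _ => rfl

/-- A sequence of roots with trivial image in the tilt is trivial. -/
lemma eq_one_of_ofRoots_eq_one {x : ℕ → 𝓞_ℂ_[p]} {hx : ∀ n, x (n + 1) ^ p = x n}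
    (h : ofRoots x hx = 1) (n : ℕ) : x n = 1 := by
  have hpow : ∀ k, x (n + k) ^ p ^ k = x n := fun k => by
    induction k with
    | zero => simp
    | succ k ih => rw [pow_succ', pow_mul, ← add_assoc, hx, ih]
  have hdvd : ∀ m, (p : 𝓞_ℂ_[p]) ∣ x m - 1 := fun m => by
    have h1 : PreTilt.coeff m (ofRoots x hx) = 1 := by rw [h, map_one]
    rw [← Ideal.mem_span_singleton, ← Ideal.Quotient.eq]
    exact h1
  have hle : ∀ k : ℕ, Valued.v ((x n - 1 : 𝓞_ℂ_[p]) : ℂ_[p]) ≤ (1 / p : ℝ≥0) ^ k := fun k => by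
    have h1 := dvd_sub_pow_of_dvd_sub (hdvd (n + k)) k
    rw [hpow, one_pow] at h1
    have h2 := (PadicComplexInt.integers p).le_iff_dvd.2 ((pow_dvd_pow _ k.le_succ).trans h1)
    rw [map_pow, map_natCast, map_pow, PadicComplex.valuation_p] at h2
    exact h2
  have h0 : Valued.v ((x n - 1 : 𝓞_ℂ_[p]) : ℂ_[p]) ≤ 0 := by
    refine ge_of_tendsto' (NNReal.tendsto_pow_atTop_nhds_zero_of_lt_one ?_) hle
    rw [one_div]
    exact inv_lt_one_of_one_lt₀ (by exact_mod_cast (Fact.out : p.Prime).one_lt)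
  rw [nonpos_iff_eq_zero, Valuation.zero_iff] at h0
  exact sub_eq_zero.1 (Subtype.ext h0)

variable {K : IntermediateField ℚ_[p] (PadicAlgCl p)}

lemma conjFlat_resFlat [FiniteDimensional ℚ_[p] K] {σ : PadicAlgCl p ≃ₐ[ℚ_[p]] PadicAlgCl p}
    (hσ : σ ∈ K.fixingSubgroup) (x : resField K) : conjFlat σ (resFlat K x) = resFlat K x := by
  have h : (conjFlat σ).comp (resFlat K) = resFlat K := by
    refine Perfection.hom_ext p fun x => ?_
    change conjModP σ (resModP K x) = resModP K x
    rw [resModP, RingHom.comp_apply]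
    obtain ⟨a, ha⟩ := residue_surjective (R := intRing K)
      ((iterateFrobeniusEquiv (resField K) p (ramExp K)).symm x)
    have h1 : ((iterateFrobeniusEquiv (resField K) p (ramExp K)).symm : resField K →+* resField K) x
      = residue (intRing K) a := ha.symm
    have h2 : resPow K (residue (intRing K) a) =
      Ideal.Quotient.mk _ (intRingHom K a) ^ p ^ ramExp K := rfl
    rw [h1, h2, map_pow, conjModP_mk]
    congr 2
    refine Subtype.ext ?_
    have h3 : σ ((a : K) : PadicAlgCl p) = ((a : K) : PadicAlgCl p) :=
      (IntermediateField.mem_fixingSubgroup_iff _ _).1 hσ _ (a : K).2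
    change conjC σ (((a : K) : PadicAlgCl p) : ℂ_[p]) = (((a : K) : PadicAlgCl p) : ℂ_[p])
    rw [conjC_coe, h3]
  exact RingHom.congr_fun h x

/-- The image of the field of norms of `L / K` is fixed by the automorphisms fixing `L`. -/
lemma conjFlat_of_mem_normFieldInt [FiniteDimensional ℚ_[p] K]
    {L : IntermediateField ℚ_[p] (PadicAlgCl p)} (hKL : K ≤ L)
    {σ : PadicAlgCl p ≃ₐ[ℚ_[p]] PadicAlgCl p} (hσ : σ ∈ L.fixingSubgroup) {x : OCpFlat p}
    (hx : x ∈ normFieldInt K L) : conjFlat σ x = x := by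
  obtain ⟨α, hα⟩ := hx
  have : Nonempty (FinSubext K L) := ⟨⟨K, le_rfl, hKL, inferInstance⟩⟩
  have : IsDirectedOrder (FinSubext K L) := ⟨fun M N => by
    have := M.2.2.2
    have := N.2.2.2
    exact ⟨⟨M.1 ⊔ N.1, M.2.1.trans le_sup_left, sup_le M.2.2.1 N.2.2.1,
      IntermediateField.finiteDimensional_sup _ _⟩, le_sup_left (a := M.1),
      le_sup_right (a := M.1)⟩⟩
  refine Perfection.ext fun n => ?_
  -- The coordinates of `x` are limits of powers of elements of `L`.
  obtain ⟨y, hy, hlim⟩ := hα n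
  change PreTilt.coeff n (conjFlat σ x) = PreTilt.coeff n x
  rw [coeff_conjFlat, hy, conjModP_mk]
  congr 1
  refine Subtype.ext (tendsto_nhds_unique ?_ hlim)
  refine (((isometry_conjC σ).continuous.tendsto (y : ℂ_[p])).comp hlim).congr fun M => ?_
  have h1 : σ ((α.comp M : M.1) : PadicAlgCl p) = ((α.comp M : M.1) : PadicAlgCl p) :=
    (IntermediateField.mem_fixingSubgroup_iff _ _).1 hσ _ (M.2.2.1 (α.comp M).2)
  rw [Function.comp_apply, map_pow, conjC_coe, h1]

lemma IsEta.conjFlat_eq [FiniteDimensional ℚ_[p] K] {η : OCpFlat p} (hη : IsEta K η)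
    {σ : PadicAlgCl p ≃ₐ[ℚ_[p]] PadicAlgCl p} (hσ : σ ∈ (cyclotomic K).fixingSubgroup) :
    conjFlat σ η = η := by
  obtain ⟨ω, ⟨hω, -⟩, a, b, hab⟩ := hη
  have h1 : conjFlat σ η ^ p ^ a = η ^ p ^ a := by
    rw [← map_pow, hab, map_pow, conjFlat_of_mem_normFieldInt le_sup_left hσ hω]
  exact (bijective_iterateFrobenius (OCpFlat p) p a).1 h1

lemma IsEta.norm_lt_one {η : OCpFlat p} (hη : IsEta K η) : ‖η‖ < 1 := by
  obtain ⟨ω, ⟨-, -, hω, -⟩, a, b, hab⟩ := hη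
  have hp := (Fact.out : p.Prime).ne_zero
  rw [zero_lt_vFlat_iff, tiltAbs_ofInt] at hω
  have : NormOneClass (OCpFlat p) := NormMulClass.toNormOneClass
  have h1 : ‖η‖ ^ p ^ a < 1 := by
    rw [← norm_pow, hab, norm_pow]
    exact pow_lt_one₀ (norm_nonneg _) (by exact_mod_cast hω) (pow_ne_zero _ hp)
  exact (pow_lt_one_iff_of_nonneg (norm_nonneg _) (pow_ne_zero _ hp)).1 h1

lemma IsEta.ne_zero {η : OCpFlat p} (hη : IsEta K η) : η ≠ 0 := by
  obtain ⟨ω, ⟨-, hω, -⟩, a, b, hab⟩ := hη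
  rintro rfl
  rw [zero_pow (pow_ne_zero _ (Fact.out : p.Prime).ne_zero)] at hab
  exact pow_ne_zero _ hω hab.symm

/-- Roots in `ℂ_p` of elements of `PadicAlgCl p` lie in `PadicAlgCl p`. -/
lemma exists_coe_eq_of_pow_eq {z : ℂ_[p]} {a : PadicAlgCl p} {m : ℕ} (hm : m ≠ 0)
    (h : z ^ m = (a : ℂ_[p])) : ∃ b : PadicAlgCl p, (b : ℂ_[p]) = z := by
  by_cases ha : a = 0
  · rw [ha, PadicComplex.coe_zero] at h
    exact ⟨0, by rw [PadicComplex.coe_zero, eq_zero_of_pow_eq_zero h]⟩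
  have : NeZero m := ⟨hm⟩
  obtain ⟨b, hb⟩ := IsAlgClosed.exists_pow_nat_eq a (Nat.pos_of_ne_zero hm)
  obtain ⟨ζ, hζ⟩ := HasEnoughRootsOfUnity.exists_primitiveRoot (PadicAlgCl p) m
  have hb0 : b ≠ 0 := by
    rintro rfl
    exact ha (by rw [← hb, zero_pow hm])
  have hζ' : IsPrimitiveRoot (algebraMap (PadicAlgCl p) ℂ_[p] ζ) m :=
    hζ.map_of_injective (algebraMap (PadicAlgCl p) ℂ_[p]).injective
  have hb0' : algebraMap (PadicAlgCl p) ℂ_[p] b ≠ 0 := by rwa [Ne, map_eq_zero]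
  have h1 : (z / algebraMap (PadicAlgCl p) ℂ_[p] b) ^ m = 1 := by
    rw [div_pow, h, ← map_pow, hb, PadicComplex.coe_eq, div_self]
    rwa [Ne, map_eq_zero]
  obtain ⟨i, -, hi⟩ := hζ'.eq_pow_of_pow_eq_one h1
  refine ⟨ζ ^ i * b, ?_⟩
  rw [PadicComplex.coe_eq, map_mul, map_pow, hi, div_mul_cancel₀ _ hb0']

/-- An automorphism fixing `K(ζ_{p^∞})` that moves some `p`-power root of the uniformizer
multiplies `u_K` by a unit `q ≠ 1` that is a compatible system of `p`-power roots of unity. -/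
lemma IsUniformizer.exists_conjFlat_ofRoots_eq {π : K} (hπ : IsUniformizer K π)
    {ϖ : ℕ → 𝓞_ℂ_[p]} (hϖ₀ : (ϖ 0 : ℂ_[p]) = ((π : PadicAlgCl p) : ℂ_[p]))
    (hϖ : ∀ n, ϖ (n + 1) ^ p = ϖ n) :
    ∃ σ ∈ (cyclotomic K).fixingSubgroup, ∃ q : (OCpFlat p)ˣ, q ≠ 1 ∧ ‖(q : OCpFlat p) - 1‖ < 1 ∧
      Units.map (conjFlat σ : OCpFlat p →* OCpFlat p) q = q ∧
      conjFlat σ (ofRoots ϖ hϖ) = q * ofRoots ϖ hϖ := by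
  have hp := (Fact.out : p.Prime)
  have hcoe : Function.Injective ((↑) : PadicAlgCl p → ℂ_[p]) :=
    (algebraMap (PadicAlgCl p) ℂ_[p]).injective
  have hcoe_pow : ∀ (x : PadicAlgCl p) (m : ℕ), ((x ^ m : PadicAlgCl p) : ℂ_[p]) = (x : ℂ_[p]) ^ m :=
    map_pow (algebraMap (PadicAlgCl p) ℂ_[p])
  have hpow : ∀ n, (ϖ n : ℂ_[p]) ^ p ^ n = ((π : PadicAlgCl p) : ℂ_[p]) := fun n => by
    induction n with
    | zero => simpa using hϖ₀
    | succ n ih =>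
      have h1 : (ϖ (n + 1) : ℂ_[p]) ^ p = ϖ n := congrArg Subtype.val (hϖ n)
      rw [pow_succ', pow_mul, h1, ih]
  choose r hr using fun n => exists_coe_eq_of_pow_eq (pow_ne_zero n hp.ne_zero) (hpow n)
  have hr0 : r 0 = π := hcoe ((hr 0).trans hϖ₀)
  have hrp : ∀ n, r (n + 1) ^ p = r n := fun n => hcoe (by
    rw [hcoe_pow, hr, hr]
    exact congrArg Subtype.val (hϖ n))
  have hπ0 : (π : PadicAlgCl p) ≠ 0 := fun h => hπ.1 (Subtype.ext h)
  have hrpow : ∀ n, r n ^ p ^ n = π := fun n => hcoe (by rw [hcoe_pow, hr, hpow])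
  have hrne : ∀ n, r n ≠ 0 := fun n h => hπ0 (by
    rw [← hrpow n, h, zero_pow (pow_ne_zero n hp.ne_zero)])
  obtain ⟨N, hN⟩ := hπ.exists_notMem_cyclotomic hr0 hrp
  obtain ⟨σ, hσ, hσN⟩ : ∃ σ ∈ (cyclotomic K).fixingSubgroup, σ (r N) ≠ r N := by
    by_contra! h
    exact hN (mem_of_forall_fixingSubgroup _ h)
  have hfix : ∀ x ∈ cyclotomic K, σ x = x := (IntermediateField.mem_fixingSubgroup_iff _ _).1 hσ
  have hσπ : σ π = π := hfix _ ((le_sup_left : K ≤ cyclotomic K) π.2)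
  let ζ : ℕ → PadicAlgCl p := fun n => σ (r n) / r n
  have hσr : ∀ n, σ (r n) ≠ 0 := fun n => (map_ne_zero σ).2 (hrne n)
  have hζ1 : ∀ n, ζ n ^ p ^ n = 1 := fun n => by
    simp only [ζ]
    rw [div_pow, ← map_pow, hrpow, hσπ, div_self hπ0]
  have hζp : ∀ n, ζ (n + 1) ^ p = ζ n := fun n => by
    simp only [ζ]
    rw [div_pow, ← map_pow, hrp]
  have hζσ : ∀ n, σ (ζ n) = ζ n := fun n => hfix _ ((le_sup_right : _ ≤ cyclotomic K)
    (IntermediateField.subset_adjoin _ _ ⟨n, hζ1 n⟩))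
  have hζn : ∀ n, ‖ζ n‖ = 1 := fun n => by
    simp only [ζ]
    rw [norm_div, norm_algEquiv, div_self (norm_ne_zero_iff.2 (hrne n))]
  let Z : ℕ → 𝓞_ℂ_[p] := fun n => ⟨(ζ n : ℂ_[p]), by
    change Valued.v (ζ n : ℂ_[p]) ≤ 1
    rw [← NNReal.coe_le_coe, ← norm_eq_valued, PadicComplex.norm_extends, hζn, NNReal.coe_one]⟩
  let Z' : ℕ → 𝓞_ℂ_[p] := fun n => ⟨((ζ n)⁻¹ : PadicAlgCl p), by
    change Valued.v (((ζ n)⁻¹ : PadicAlgCl p) : ℂ_[p]) ≤ 1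
    rw [← NNReal.coe_le_coe, ← norm_eq_valued, PadicComplex.norm_extends, norm_inv, hζn, inv_one,
      NNReal.coe_one]⟩
  have hZ : ∀ n, Z (n + 1) ^ p = Z n := fun n => Subtype.ext (by
    change (ζ (n + 1) : ℂ_[p]) ^ p = ζ n
    rw [← hcoe_pow, hζp])
  have hZ' : ∀ n, Z' (n + 1) ^ p = Z' n := fun n => Subtype.ext (by
    change (((ζ (n + 1))⁻¹ : PadicAlgCl p) : ℂ_[p]) ^ p = ((ζ n)⁻¹ : PadicAlgCl p)
    rw [← hcoe_pow, inv_pow, hζp])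
  have hZZ' : ofRoots Z hZ * ofRoots Z' hZ' = 1 := by
    have h1 : ∀ n, (Z * Z') n = 1 := fun n => Subtype.ext (by
      change algebraMap (PadicAlgCl p) ℂ_[p] (ζ n) * algebraMap (PadicAlgCl p) ℂ_[p] (ζ n)⁻¹ = 1
      rw [← map_mul, mul_inv_cancel₀ (div_ne_zero (hσr n) (hrne n)), map_one])
    rw [ofRoots_mul]
    refine Perfection.ext fun n => ?_
    change Ideal.Quotient.mk _ ((Z * Z') n) = 1
    rw [h1, map_one]
  have hconjZ : conjFlat σ (ofRoots Z hZ) = ofRoots Z hZ := by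
    rw [conjFlat_ofRoots]
    congr 1
    funext n
    refine Subtype.ext ?_
    change conjC σ (ζ n : ℂ_[p]) = ζ n
    rw [conjC_coe, hζσ]
  refine ⟨σ, hσ, ⟨ofRoots Z hZ, ofRoots Z' hZ', hZZ', by rw [mul_comm, hZZ']⟩, ?_, ?_,
    Units.ext hconjZ, ?_⟩
  · intro h
    have h1 := eq_one_of_ofRoots_eq_one (hx := hZ) (congrArg Units.val h) N
    have h2 : (ζ N : ℂ_[p]) = (1 : PadicAlgCl p) := congrArg Subtype.val h1
    exact hσN (eq_of_div_eq_one (hcoe h2))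
  · have h1 : Z 0 = 1 := Subtype.ext (by
      change (ζ 0 : ℂ_[p]) = (1 : PadicAlgCl p)
      rw [← pow_one (ζ 0), ← pow_zero p, hζ1])
    have h2 : PreTilt.coeff 0 (ofRoots Z hZ) = PreTilt.coeff 0 (1 : OCpFlat p) := by
      rw [map_one]
      change Ideal.Quotient.mk _ (Z 0) = 1
      rw [h1, map_one]
    refine ((coeff_eq_iff_norm_sub_le _ _ 0).1 h2).trans_lt ?_
    rw [pow_zero, pow_one, one_div, NNReal.coe_lt_one]
    exact inv_lt_one_of_one_lt₀ (by exact_mod_cast hp.one_lt)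
  · rw [conjFlat_ofRoots]
    change _ = ofRoots Z hZ * ofRoots ϖ hϖ
    rw [ofRoots_mul]
    congr 1
    funext n
    refine Subtype.ext ?_
    change conjC σ (ϖ n : ℂ_[p]) = (ζ n : ℂ_[p]) * (ϖ n : ℂ_[p])
    rw [← hr, conjC_coe]
    change _ = algebraMap (PadicAlgCl p) ℂ_[p] (ζ n) * algebraMap (PadicAlgCl p) ℂ_[p] (r n)
    rw [← map_mul, div_mul_cancel₀ _ (hrne n)]
    rfl

lemma IsUniformizer.norm_ofRoots {π : K} (hπ : IsUniformizer K π)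
    {ϖ : ℕ → 𝓞_ℂ_[p]} (hϖ₀ : (ϖ 0 : ℂ_[p]) = ((π : PadicAlgCl p) : ℂ_[p]))
    (hϖ : ∀ n, ϖ (n + 1) ^ p = ϖ n) : ‖ofRoots ϖ hϖ‖ = ‖π‖ := by
  have hπ0 : (π : PadicAlgCl p) ≠ 0 := fun h => hπ.1 (Subtype.ext h)
  have h0 : ϖ 0 ≠ 0 := fun h => by
    rw [h] at hϖ₀
    exact hπ0 ((algebraMap (PadicAlgCl p) ℂ_[p]).injective (hϖ₀.symm.trans (map_zero _).symm))
  rw [norm_eq_tiltAbsInt, tiltAbsInt_ofRoots ϖ hϖ h0, ← norm_eq_valued, hϖ₀,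
    PadicComplex.norm_extends]
  rfl

end GaloisAction

/-! ### Evaluation of power series in the tilt -/

section TiltEval

attribute [local instance] normMulClass_tilt

variable {p : ℕ} [Fact p.Prime]

lemma ofInt_sum {ι : Type*} (s : Finset ι) (x : ι → OCpFlat p) :
    ofInt (∑ i ∈ s, x i) = ∑ i ∈ s, ofInt (x i) := map_sum (algebraMap (OCpFlat p) (CpFlat p)) x s

lemma ofInt_mul (x y : OCpFlat p) : ofInt (x * y) = ofInt x * ofInt y :=
  map_mul (algebraMap (OCpFlat p) (CpFlat p)) x y

lemma ofInt_pow (x : OCpFlat p) (n : ℕ) : ofInt (x ^ n) = ofInt x ^ n :=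
  map_pow (algebraMap (OCpFlat p) (CpFlat p)) x n

/-- The power series `f = ∑ f_j(X) Y^j` as the sequence of the `f_j`. -/
def rows {k : Type*} [CommRing k] (f : MvPowerSeries (Fin 2) k) (j : ℕ) : PowerSeries k :=
  PowerSeries.mk fun i => coeff₂ f i j

@[simp]
lemma coeff_rows {k : Type*} [CommRing k] (f : MvPowerSeries (Fin 2) k) (i j : ℕ) :
    PowerSeries.coeff i (rows f j) = coeff₂ f i j := PowerSeries.coeff_mk _ _

lemma rows_sub {k : Type*} [CommRing k] (f g : MvPowerSeries (Fin 2) k) :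
    rows (f - g) = rows f - rows g := by
  funext j
  ext i
  simp [coeff₂]

lemma eq_zero_of_rows_eq_zero {k : Type*} [CommRing k] {f : MvPowerSeries (Fin 2) k}
    (h : rows f = 0) : f = 0 := by
  ext m
  have h1 := congrArg (PowerSeries.coeff (m 0)) (congrFun h (m 1))
  rw [coeff_rows, coeff₂] at h1
  have h2 : Finsupp.single 0 (m 0) + Finsupp.single 1 (m 1) = m := by
    ext i
    fin_cases i <;> simp
  simpa [h2] using h1

variable {K : IntermediateField ℚ_[p] (PadicAlgCl p)} [FiniteDimensional ℚ_[p] K]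

lemma eval₁_ofInt {u : OCpFlat p} (hu : ‖u‖ < 1) (F : PowerSeries (resField K)) :
    eval₁ F (ofInt u) = ofInt (evalAt (resFlat K) u F) := by
  refine tiltLim_eq ?_
  have h1 := (summable_norm_mul_pow norm_le_one_tilt hu
    fun i => resFlat K (PowerSeries.coeff i F)).of_norm.hasSum.tendsto_sum_nat
  convert isTiltLimit_ofInt (h1.comp (tendsto_add_atTop_nat 1)) using 2 with n
  · simp [ofInt_sum, ofInt_mul, ofInt_pow]
  · rfl

lemma isTiltLimit_partialSum₂ {u b : OCpFlat p} (hu : ‖u‖ < 1) (hb : ‖b‖ < 1)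
    (f : MvPowerSeries (Fin 2) (resField K)) :
    IsTiltLimit (partialSum₂ f (ofInt u) (ofInt b))
      (ofInt (evalAt₂ (resFlat K) u b (rows f))) := by
  have h1 := (summable_norm_mul_pow₂ norm_le_one_tilt hu hb
    fun α => resFlat K (PowerSeries.coeff α.1 (rows f α.2))).of_norm.hasSum
  have h2 : Tendsto (fun n : ℕ => Finset.range (n + 1) ×ˢ Finset.range (n + 1)) atTop atTop := by
    refine tendsto_atTop_finset_of_monotone (fun m n hmn => ?_) fun α => ⟨max α.1 α.2, ?_⟩
    · have := Finset.range_mono (Nat.add_le_add_right hmn 1)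
      exact Finset.product_subset_product this this
    · simp
  convert isTiltLimit_ofInt (h1.comp h2) using 2 with n
  · simp [ofInt_sum, ofInt_mul, ofInt_pow, Finset.sum_product, partialSum₂]
  · rfl

lemma eval₂_ofInt {u b : OCpFlat p} (hu : ‖u‖ < 1) (hb : ‖b‖ < 1)
    (f : MvPowerSeries (Fin 2) (resField K)) :
    eval₂ f (ofInt u) (ofInt b) = ofInt (evalAt₂ (resFlat K) u b (rows f)) :=
  tiltLim_eq (isTiltLimit_partialSum₂ hu hb f)

lemma evalAt₂_sub {u b : OCpFlat p} (hu : ‖u‖ < 1) (hb : ‖b‖ < 1)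
    (f g : ℕ → PowerSeries (resField K)) :
    evalAt₂ (resFlat K) u b (f - g) =
      evalAt₂ (resFlat K) u b f - evalAt₂ (resFlat K) u b g := by
  rw [evalAt₂, evalAt₂, evalAt₂,
    ← (summable_norm_mul_pow₂ norm_le_one_tilt hu hb _).of_norm.tsum_sub
      (summable_norm_mul_pow₂ norm_le_one_tilt hu hb _).of_norm]
  refine tsum_congr fun α => ?_
  simp only [Pi.sub_apply, map_sub]
  ring

end TiltEval

end FalseTate

end

open FalseTate in
theorem proposition60072 (p : ℕ) [Fact p.Prime] (hp : 3 ≤ p)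
    (K : IntermediateField ℚ_[p] (PadicAlgCl p)) [FiniteDimensional ℚ_[p] K]
    (π : K) (hπ : IsUniformizer K π)
    (ϖ : ℕ → 𝓞_ℂ_[p]) (hϖ₀ : (ϖ 0 : ℂ_[p]) = ((π : PadicAlgCl p) : ℂ_[p]))
    (hϖ : ∀ n, ϖ (n + 1) ^ p = ϖ n)
    (η₀ : OCpFlat p) (hη₀ : IsEta K η₀)
    (u η : CpFlat p) (hu : u = ofInt (ofRoots ϖ hϖ)) (hη : η = ofInt η₀) :
    (∀ (θ : ℕ) (F : PowerSeries (resField K)), 1 ≤ θ → F ≠ 0 → 0 < vFlat (η ^ θ / eval₁ F u) →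
      (∀ f : MvPowerSeries (Fin 2) (resField K),
        IsTiltLimit (partialSum₂ f u (η ^ θ / eval₁ F u)) (eval₂ f u (η ^ θ / eval₁ F u)) ∧
        ∃ y : OCpFlat p, ofInt y = eval₂ f u (η ^ θ / eval₁ F u)) ∧
      (∀ n : ℕ, ∃ M : ℚ, 0 < M ∧ ∀ f : MvPowerSeries (Fin 2) (resField K),
        (((M : ℚ) : ℝ) : WithTop ℝ) < vFlat (eval₂ f u (η ^ θ / eval₁ F u)) →
        ∀ i j : ℕ, i ≤ n → j ≤ n → coeff₂ f i j = 0) ∧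
      Function.Injective (fun f : MvPowerSeries (Fin 2) (resField K) =>
        eval₂ f u (η ^ θ / eval₁ F u))) ∧
    Function.Injective (fun f : MvPowerSeries (Fin 2) (resField K) => eval₂ f u η) := by
  have := normMulClass_tilt p
  have hu1 : ‖ofRoots ϖ hϖ‖ < 1 := by rw [hπ.norm_ofRoots hϖ₀]; exact hπ.2.1
  have hu0 : ofRoots ϖ hϖ ≠ 0 := by
    rw [← norm_ne_zero_iff, hπ.norm_ofRoots hϖ₀]
    exact norm_ne_zero_iff.2 hπ.1
  obtain ⟨σ, hσ, q, hq1, hq, hσq, hσu⟩ := hπ.exists_conjFlat_ofRoots_eq hϖ₀ hϖ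
  have hσK : σ ∈ K.fixingSubgroup := IntermediateField.fixingSubgroup_antitone le_sup_left hσ
  set u₀ := ofRoots ϖ hϖ
  have hp1 : (1 : ℝ) < p := by exact_mod_cast (Fact.out : p.Prime).one_lt
  have main : ∀ (θ : ℕ) (F : PowerSeries (resField K)), F ≠ 0 →
      0 < vFlat (η ^ θ / eval₁ F u) →
      (∀ f : MvPowerSeries (Fin 2) (resField K),
        IsTiltLimit (partialSum₂ f u (η ^ θ / eval₁ F u)) (eval₂ f u (η ^ θ / eval₁ F u)) ∧
        ∃ y : OCpFlat p, ofInt y = eval₂ f u (η ^ θ / eval₁ F u)) ∧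
      (∀ n : ℕ, ∃ M : ℚ, 0 < M ∧ ∀ f : MvPowerSeries (Fin 2) (resField K),
        (((M : ℚ) : ℝ) : WithTop ℝ) < vFlat (eval₂ f u (η ^ θ / eval₁ F u)) →
        ∀ i j : ℕ, i ≤ n → j ≤ n → coeff₂ f i j = 0) ∧
      Function.Injective (fun f : MvPowerSeries (Fin 2) (resField K) =>
        eval₂ f u (η ^ θ / eval₁ F u)) := by
    intro θ F hF hv
    have hw0 : evalAt (resFlat K) u₀ F ≠ 0 := evalAt_ne_zero norm_le_one_tilt hu0 hu1 hF
    have hw0' : ofInt (evalAt (resFlat K) u₀ F) ≠ 0 := fun h =>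
      hw0 (ofInt_injective (h.trans (map_zero (algebraMap (OCpFlat p) (CpFlat p))).symm))
    rw [zero_lt_vFlat_iff] at hv
    obtain ⟨b, hb⟩ := exists_ofInt_eq hv.le
    rw [← hb, tiltAbs_ofInt] at hv
    have hb1 : ‖b‖ < 1 := by rw [norm_eq_tiltAbsInt]; exact_mod_cast hv
    have hbw : b * evalAt (resFlat K) u₀ F = η₀ ^ θ := by
      refine ofInt_injective ?_
      rw [ofInt_mul, hb, hu, eval₁_ofInt hu1, div_mul_cancel₀ _ hw0', hη, ofInt_pow]
    have hσe : conjFlat σ (η₀ ^ θ) = η₀ ^ θ := by rw [map_pow, hη₀.conjFlat_eq hσ]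
    have hinj : ∀ f : ℕ → PowerSeries (resField K), evalAt₂ (resFlat K) u₀ b f = 0 → f = 0 :=
      fun f hf => eq_zero_of_evalAt₂_eq_zero p norm_le_one_tilt hq1 hq (continuous_conjFlat σ) hσq
        (conjFlat_resFlat hσK) hσu hσe hu0 hu1 hb1 (pow_ne_zero θ hη₀.ne_zero) hF hbw hf
    rw [← hb, hu]
    refine ⟨fun f => ?_, fun n => ?_, fun f g hfg => ?_⟩
    · rw [eval₂_ofInt hu1 hb1]
      exact ⟨isTiltLimit_partialSum₂ hu1 hb1 f, _, rfl⟩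
    · obtain ⟨δ, hδ, hδn⟩ := exists_pos_forall_norm_evalAt₂_lt norm_le_one_tilt hu1 hb1 hinj n
      obtain ⟨m, hm⟩ := exists_pow_lt_of_lt_one hδ (inv_lt_one_of_one_lt₀ hp1)
      refine ⟨m + 1, by positivity, fun f hf i j hi hj => ?_⟩
      rw [eval₂_ofInt hu1 hb1, lt_vFlat_iff, tiltAbs_ofInt] at hf
      rw [← coeff_rows]
      refine hδn _ (hf.trans (lt_of_le_of_lt ?_ hm)) i j hi hj
      rw [inv_pow, ← Real.rpow_natCast, ← Real.rpow_neg (by positivity)]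
      refine Real.rpow_le_rpow_of_exponent_le hp1.le ?_
      push_cast
      linarith
    · have h1 : ofInt (evalAt₂ (resFlat K) u₀ b (rows f)) =
          ofInt (evalAt₂ (resFlat K) u₀ b (rows g)) := by
        rw [← eval₂_ofInt hu1 hb1, ← eval₂_ofInt hu1 hb1]
        exact hfg
      rw [← sub_eq_zero]
      refine eq_zero_of_rows_eq_zero (hinj _ ?_)
      rw [rows_sub, evalAt₂_sub hu1 hb1, ofInt_injective h1, sub_self]
  refine ⟨fun θ F _ => main θ F, ?_⟩
  have h1 : η ^ 1 / eval₁ (1 : PowerSeries (resField K)) u = η := by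
    rw [hu, eval₁_ofInt hu1, evalAt_one, pow_one]
    exact (congrArg (η / ·) (map_one (algebraMap (OCpFlat p) (CpFlat p)))).trans (div_one η)
  have h2 := main 1 1 one_ne_zero
  rw [h1] at h2
  refine (h2 ?_).2.2
  rw [hη, zero_lt_vFlat_iff, tiltAbs_ofInt]
  exact_mod_cast hη₀.norm_lt_one
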